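/- Let $k$ be an algebraically closed field of characteristic zero, $R=k[x_0,\dots,x_n]=\mathrm{Sym}(V)$ the homogeneous coordinate ring of $\mathbb P^n=\mathbb P(V)$, where $V=R_1$ is the space of linear forms, and let $X\subset\mathbb P^n$ be a non-degenerate (i.e. contained in no hyperplane) reduced closed subscheme. Let $d\ge 2$ and $1\le t\le p$ be integers. Suppose that $X$ satisfies property $\mathbf N_{d,p}$ scheme-theoretically with an ideal $I$; that is, $I\subset R$ is a homogeneous ideal generating the ideal sheaf of $X$ in $\mathbb P^n$, and $\mathrm{Tor}^R_i(R/I,k)$ is concentrated in degrees $<d+i$ for all $0\le i\le p$. Let $V=U\oplus W$ be a decomposition with $\dim_k U=t$, let $\Lambda=Z(W)=\mathbb P(U)\cong\mathbb P^{t-1}$ be the linear subspace of $\mathbb P^n$ on which all forms in $W$ vanish, and suppose $\Lambda\cap X=\emptyset$. Let $S_t=\mathrm{Sym}(W)\subset R$ be the polynomial subring generated by $W$, and let $I_{\ge d}=\bigoplus_{m\ge d}I_m$. Then the minimal graded free resolution of $R/I_{\ge d}$ as a graded $S_t$-module has the form $$\cdots\to L_{p-t}\to\cdots\to L_1\to\bigoplus_{i=0}^{d-1}\mathrm{Sym}^i(U)\otimes_k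 S_t(-i)\to R/I_{\ge d}\to 0,$$ where $\mathrm{Sym}^i(U)\subset R_i$ is the space of forms of degree $i$ generated by $U$, the augmentation is given by $u\otimes s\mapsto us \bmod I_{\ge d}$, and $L_i=S_t(-i-d+1)^{\beta_{i,d-1}}$ for $1\le i\le p-t$, with $\beta_{i,j}=\dim_k\mathrm{Tor}^{S_t}_i(R/I_{\ge d},k)_{i+j}$. In particular, if $d=2$, then the minimal graded free resolution of $R/I$ as a graded $S_t$-module has the form $$\cdots\to S_t(-p+t-1)^{\beta_{p-t,1}}\to\cdots\to S_t(-2)^{\beta_{1,1}}\to S_t\oplus S_t(-1)^{t}\to R/I\to 0,$$ where $\beta_{i,j}=\dim_k\mathrm{Tor}^{S_t}_i(R/I,k)_{i+j}$ (for $p=t$ the displayed part is only the zeroth term). -/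

import Mathlib

open AlgebraicGeometry CategoryTheory
open scoped TensorProduct

universe u v w

noncomputable section

namespace GradedSyzygies

section Resolutions

variable {k : Type u} {S : Type v} {M : Type w} [Field k] [CommRing S] [Algebra k S]
  [AddCommGroup M] [Module k M] [Module S M]

/-- The degree `j` component `S(-a)_j = S_{j-a}` of the shifted free module `S(-a)`. -/
def twist (𝒮 : ℕ → Submodule k S) (a j : ℕ) : Submodule k S :=
  if a ≤ j then 𝒮 (j - a) else ⊥

/-- The degree `j` component of the graded free module `⨁_b S(-a b)`, for a finite family of
shifts `a`. -/
def freePart (𝒮 : ℕ → Submodule k S) {r : ℕ} (a : Fin r → ℕ) (j : ℕ) :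
    Submodule k (Fin r → S) :=
  Submodule.pi Set.univ fun b => twist 𝒮 (a b) j

/-- The ideal `S_+` generated by the homogeneous elements of positive degree. -/
def irrelevantIdeal (𝒮 : ℕ → Submodule k S) : Ideal S :=
  Ideal.span {s | ∃ j, 0 < j ∧ s ∈ 𝒮 j}

/-- The submodule `S_+ F` of the free module `F = S^r`. -/
def irrelevantPart (𝒮 : ℕ → Submodule k S) (r : ℕ) : Submodule k (Fin r → S) :=
  Submodule.pi Set.univ fun _ => (irrelevantIdeal 𝒮).restrictScalars k

/-- A graded free resolution `⋯ → F₁ → F₀ → M → 0` of the graded module `M` (with graded pieces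
`ℳ j`) over the graded `k`-algebra `S` (with graded pieces `𝒮 j`), where
`Fᵢ = ⨁_b S(-shift i b)` has finite rank `rank i` and all maps are homogeneous of degree zero. -/
structure GradedFreeResolution (𝒮 : ℕ → Submodule k S) (ℳ : ℕ → Submodule k M) where
  /-- the rank of `Fᵢ` -/
  rank : ℕ → ℕ
  /-- the degrees of the basis elements of `Fᵢ` -/
  shift : ∀ i, Fin (rank i) → ℕ
  /-- the differential `Fᵢ₊₁ → Fᵢ` -/
  d : ∀ i, (Fin (rank (i + 1)) → S) →ₗ[S] (Fin (rank i) → S)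
  /-- the augmentation `F₀ → M` -/
  ε : (Fin (rank 0) → S) →ₗ[S] M
  d_homogeneous : ∀ i j, ∀ v ∈ freePart 𝒮 (shift (i + 1)) j, d i v ∈ freePart 𝒮 (shift i) j
  ε_homogeneous : ∀ j, ∀ v ∈ freePart 𝒮 (shift 0) j, ε v ∈ ℳ j
  ε_surjective : Function.Surjective ε
  exact_zero : Function.Exact (d 0) ε
  exact_succ : ∀ i, Function.Exact (d (i + 1)) (d i)

namespace GradedFreeResolution

variable {𝒮 : ℕ → Submodule k S} {ℳ : ℕ → Submodule k M} (F : GradedFreeResolution 𝒮 ℳ)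

/-- The degree `j` component `(Fᵢ)_j`. -/
def part (i j : ℕ) : Submodule k (Fin (F.rank i) → S) := freePart 𝒮 (F.shift i) j

/-- A resolution is minimal if every differential `Fᵢ₊₁ → Fᵢ` has image in `S_+ Fᵢ`. -/
def IsMinimal : Prop :=
  ∀ i v, F.d i v ∈ irrelevantPart 𝒮 (F.rank i)

/-- Representatives in `(Fᵢ)_j` of the degree `j` cycles of `F ⊗_S S/S_+`. -/
def cycles : ∀ i : ℕ, ℕ → Submodule k (Fin (F.rank i) → S)
  | 0, j => F.part 0 j
  | i + 1, j =>
      F.part (i + 1) j ⊓ (irrelevantPart 𝒮 (F.rank i)).comap ((F.d i).restrictScalars k)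

/-- Representatives in `(Fᵢ)_j` of the degree `j` boundaries of `F ⊗_S S/S_+`. -/
def boundaries (i j : ℕ) : Submodule k (Fin (F.rank i) → S) :=
  (F.part i j ⊓ irrelevantPart 𝒮 (F.rank i)) ⊔ (F.part (i + 1) j).map ((F.d i).restrictScalars k)

/-- `Tor_i^S(M, S/S_+)_j`, computed from the resolution `F`: the degree `j` component of the
`i`-th homology of `F ⊗_S S/S_+`. For a polynomial ring `S` over `k`, `S/S_+ = k`. -/
abbrev Tor (i j : ℕ) : Type v :=
  ↥(F.cycles i j) ⧸ (F.boundaries i j).submoduleOf (F.cycles i j)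

/-- The graded Betti number `β_{i,j} = dim_k Tor_i^S(M, k)_{i+j}`. -/
def betti (i j : ℕ) : ℕ := Module.finrank k (F.Tor i (i + j))

end GradedFreeResolution

end Resolutions

section ProjectiveSpace

variable {k : Type u} [Field k] {n : ℕ}

/-- The degree `j` component of the homogeneous coordinate ring `R = k[x_0, …, x_n]` of `ℙⁿ`.
In particular `coordGrading k n 1` is the space `V` of linear forms. -/
abbrev coordGrading (k : Type u) [Field k] (n : ℕ) :
    ℕ → Submodule k (MvPolynomial (Fin (n + 1)) k) :=
  MvPolynomial.homogeneousSubmodule (Fin (n + 1)) k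

instance coordGradedAlgebra (k : Type u) [Field k] (n : ℕ) : GradedAlgebra (coordGrading k n) :=
  MvPolynomial.gradedAlgebra

/-- The degree `j` component of `R / J`. -/
def quotGrading (J : Ideal (MvPolynomial (Fin (n + 1)) k)) (j : ℕ) :
    Submodule k (MvPolynomial (Fin (n + 1)) k ⧸ J) :=
  (coordGrading k n j).map (Ideal.Quotient.mkₐ k J).toLinearMap

/-- For a space `W` of linear forms, the subalgebra `Sym(W)` of `R = Sym(V)` generated by `W`. -/
abbrev symAlg (W : Submodule k (MvPolynomial (Fin (n + 1)) k)) :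
    Subalgebra k (MvPolynomial (Fin (n + 1)) k) :=
  Algebra.adjoin k (W : Set (MvPolynomial (Fin (n + 1)) k))

/-- The degree `j` component of `Sym(W)`. -/
def symGrading (W : Submodule k (MvPolynomial (Fin (n + 1)) k)) (j : ℕ) : Submodule k (symAlg W) :=
  (coordGrading k n j).comap (symAlg W).val.toLinearMap

/-- The truncation `I_{≥ d} = ⨁_{m ≥ d} I_m` of a homogeneous ideal `I`. -/
def truncation (I : Ideal (MvPolynomial (Fin (n + 1)) k)) (d : ℕ) :
    Ideal (MvPolynomial (Fin (n + 1)) k) :=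
  Ideal.span {f | f ∈ I ∧ ∃ m, d ≤ m ∧ f ∈ coordGrading k n m}

/-- The homogeneous ideal `I` satisfies property `N_{d,p}`: `Tor_i^R(R/I, k)` is concentrated in
degrees `< d + i` for all `i ≤ p`. (`Tor` does not depend on the resolution it is
computed from.) -/
def SatisfiesN (I : Ideal (MvPolynomial (Fin (n + 1)) k)) (d p : ℕ) : Prop :=
  ∃ F : GradedFreeResolution (coordGrading k n) (quotGrading I),
    ∀ i ≤ p, ∀ j, d + i ≤ j → Subsingleton (F.Tor i j)

/-- The degree zero part of the localization `I_f`, as an ideal of `(R_f)_0`. -/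
def awayIdeal (I : Ideal (MvPolynomial (Fin (n + 1)) k)) (f : MvPolynomial (Fin (n + 1)) k) :
    Ideal (HomogeneousLocalization.Away (coordGrading k n) f) :=
  (I.map (algebraMap (MvPolynomial (Fin (n + 1)) k) (Localization.Away f))).comap
    (algebraMap (HomogeneousLocalization.Away (coordGrading k n) f) (Localization.Away f))

/-- The ideal `I` defines the closed subscheme `ι : X ↪ ℙⁿ` scheme-theoretically, i.e. it generates
the ideal sheaf `ker(𝒪_{ℙⁿ} → ι_* 𝒪_X)`: for every homogeneous `f` of positive degree, the sections
of the ideal sheaf over `D₊(f)` are `(I_f)_0`, under `𝒪(D₊(f)) = (R_f)_0`. -/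
def DefinesSchemeTheoretically (I : Ideal (MvPolynomial (Fin (n + 1)) k)) {X : Scheme.{u}}
    (ι : X ⟶ Proj (coordGrading k n)) : Prop :=
  ∀ m, 0 < m → ∀ f ∈ coordGrading k n m,
    (RingHom.ker (ι.app (Proj.basicOpen (coordGrading k n) f)).hom).comap
      (Proj.awayToSection (coordGrading k n) f).hom = awayIdeal I f

/-- The linear subspace `Z(W) ⊆ ℙⁿ` cut out by a set `W` of linear forms. -/
abbrev linearZeroLocus (W : Set (MvPolynomial (Fin (n + 1)) k)) :
    Set (Proj (coordGrading k n)) :=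
  ProjectiveSpectrum.zeroLocus (coordGrading k n) W

/-- The (reduced) subscheme `ι : X ↪ ℙⁿ` is non-degenerate: it lies in no hyperplane. -/
def IsNondegenerate {X : Scheme.{u}} (ι : X ⟶ Proj (coordGrading k n)) : Prop :=
  ∀ l ∈ coordGrading k n 1, l ≠ 0 → ¬ Set.range ι ⊆ linearZeroLocus {l}

end ProjectiveSpace

end GradedSyzygies

end

open GradedSyzygies

noncomputable section

/-! ### Graded vector spaces and connected graded algebras. -/

namespace GradedSyzygies

/-! Write `S_t = Sym(W)` and `J = I_{≥ d}`. Since `Λ ∩ X = ∅`, the ideal `I + (W)` contains a power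
of the irrelevant ideal, so `R/I` is a finite `S_t`-module (`coordGrading_le_of_disjoint`,
`finite_symAlg_quotient`). The degrees of its syzygies over `S_t` are then bounded by removing the
variables of `U` one at a time.

One variable: let `T = S[u]`, let `M` be a graded `T`-module and `G` a minimal `S`-resolution of
`M`. Multiplication by `u` on `M` lifts to `f : G(-1) → G`, and the mapping cone of `u - f : T ⊗
G(-1) → T ⊗ G` resolves `M` over `T` (`FreeRes.exists_extend`). If `s` is the largest shift in
`G_i`, a generator of degree `s + 1` of `T ⊗ G_i(-1)`, placed in homological degree `i + 1`, maps to
`T ⊗ G_i` with positive-degree coefficients, so it survives in `Tor^T_{i+1}(M, k)_{s+1}`. Hence a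
bound on `Tor^T_{i+1}` becomes one on `G_i` (`FreeRes.shift_lt_of_torVanishes`). Each variable costs
one homological step, so after `t` of them the shifts of a minimal `S_t`-resolution of `R/I` are `<
d + i` for `i ≤ p - t`.

From `R/I` to `R/J`: the kernel `I/J` is finite dimensional and lives in degrees `< d`, so it has a
resolution `H` with all shifts `< d + i`; the same cone construction, started from `S = k`, builds
it (`exists_freeRes_of_finite`). For a minimal resolution `L` of `R/J`, the cone of `H → L` resolves
`R/I`. A generator of `L_i` of degree `≥ d + i` is too large to be hit by `H_i` and would contribute
to `Tor_i(R/I, k)`. So `L` satisfies the same upper bound (`shift_lt_of_le`).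

Lower bound: `R = Sym(U) ⊗ Sym(W)` and `J` vanishes below degree `d`, so the map from `⨁_{i<d}
Sym^i(U) ⊗ S_t` to `R/J` is injective in degrees `< d`; it is onto because the generators of `R/I`
have degree `< d`. Its kernel thus starts in degree `d`, and minimality raises the degree by at
least one at each further step. The two bounds meet at `i + d - 1` for `1 ≤ i ≤ p - t`. When `d =
2`, non-degeneracy means that `I` has no forms of degree below 2, and the argument applies with `J =
I`. -/

/-- Explicit projections onto the pieces of a grading of a vector space. -/
structure Projections {k : Type*} [Field k] {M : Type*} [AddCommGroup M] [Module k M]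
    (ℳ : ℕ → Submodule k M) where
  proj : ℕ → M →ₗ[k] M
  proj_mem : ∀ j m, proj j m ∈ ℳ j
  proj_self : ∀ {j m}, m ∈ ℳ j → proj j m = m
  proj_ne : ∀ {i j m}, m ∈ ℳ i → i ≠ j → proj j m = 0
  exists_sum : ∀ m, ∃ N, ∑ j ∈ Finset.range N, proj j m = m

namespace Projections

variable {k : Type*} [Field k] {M : Type*} [AddCommGroup M] [Module k M]
  {ℳ : ℕ → Submodule k M} (P : Projections ℳ)

include P

theorem exists_bound (m : M) : ∃ N, ∀ j, N ≤ j → P.proj j m = 0 := by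
  obtain ⟨N, hN⟩ := P.exists_sum m
  refine ⟨N, fun j hj => ?_⟩
  rw [← hN, map_sum]
  refine Finset.sum_eq_zero fun i hi => P.proj_ne (P.proj_mem i m) ?_
  have := Finset.mem_range.1 hi
  omega

theorem sum_of_bound {m : M} {N : ℕ} (h : ∀ j, N ≤ j → P.proj j m = 0) :
    ∑ j ∈ Finset.range N, P.proj j m = m := by
  obtain ⟨N', hN'⟩ := P.exists_sum m
  obtain ⟨N₁, h₁⟩ := P.exists_bound m
  have key : ∀ A, (∀ j, A ≤ j → P.proj j m = 0) →
      ∑ j ∈ Finset.range A, P.proj j m = ∑ j ∈ Finset.range (max A N'), P.proj j m := by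
    intro A hA
    refine Finset.sum_subset (fun x hx => ?_) (fun x _ hx => hA x ?_)
    · simp only [Finset.mem_range] at hx ⊢; omega
    · simpa using hx
  have h2 : ∀ j, N' ≤ j → P.proj j m = 0 := by
    intro j hj
    rw [← hN', map_sum]
    refine Finset.sum_eq_zero fun i hi => P.proj_ne (P.proj_mem i m) ?_
    have := Finset.mem_range.1 hi
    omega
  rw [key N h]
  conv_rhs => rw [← hN', key N' h2, max_self]
  rcases le_total N N' with h3 | h3
  · rw [max_eq_right h3]
  · rw [max_eq_left h3, ← Finset.sum_subset (Finset.range_mono h3)]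
    intro x _ hx
    exact h2 x (by simpa using hx)

theorem induction {p : M → Prop} (hz : p 0) (ha : ∀ x y, p x → p y → p (x + y))
    (h : ∀ j, ∀ x ∈ ℳ j, p x) (m : M) : p m := by
  obtain ⟨N, hN⟩ := P.exists_sum m
  rw [← hN]
  exact Finset.sum_induction _ p ha hz fun j _ => h j _ (P.proj_mem j m)

theorem map_proj {M' : Type*} [AddCommGroup M'] [Module k M'] {ℳ' : ℕ → Submodule k M'}
    (P' : Projections ℳ') (f : M →+ M') (hf : ∀ j, ∀ x ∈ ℳ j, f x ∈ ℳ' j) (j : ℕ) (x : M) :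
    f (P.proj j x) = P'.proj j (f x) := by
  induction x using P.induction with
  | hz => simp
  | ha x y hx hy => simp [hx, hy]
  | h i x hx =>
    by_cases hij : i = j
    · subst hij
      rw [P.proj_self hx, P'.proj_self (hf _ _ hx)]
    · rw [P.proj_ne hx hij, P'.proj_ne (hf _ _ hx) hij, map_zero]

theorem exists_homogeneous_lift {M' : Type*} [AddCommGroup M'] [Module k M']
    {ℳ' : ℕ → Submodule k M'}
    (P' : Projections ℳ') (f : M →+ M') (hf : ∀ j, ∀ x ∈ ℳ j, f x ∈ ℳ' j) {j : ℕ} {y : M'}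
    (hy : y ∈ ℳ' j) (h : ∃ x, f x = y) : ∃ x ∈ ℳ j, f x = y := by
  obtain ⟨x, rfl⟩ := h
  exact ⟨P.proj j x, P.proj_mem j x, by rw [P.map_proj P' f hf, P'.proj_self hy]⟩

end Projections

/-- A connected grading of a `k`-algebra. -/
structure ConnectedGrading {k : Type*} [Field k] {S : Type*} [CommRing S] [Algebra k S]
    (𝒮 : ℕ → Submodule k S) extends Projections 𝒮 where
  mul_mem : ∀ {i j s t}, s ∈ 𝒮 i → t ∈ 𝒮 j → s * t ∈ 𝒮 (i + j)
  algebraMap_mem : ∀ c, algebraMap k S c ∈ 𝒮 0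
  exists_algebraMap : ∀ {s}, s ∈ 𝒮 0 → ∃ c, algebraMap k S c = s

/-- Compatibility of a grading of an `S`-module with the grading of `S`. -/
def IsGradedSMul {k : Type*} [Field k] {S : Type*} [CommRing S] [Algebra k S]
    (𝒮 : ℕ → Submodule k S) {M : Type*} [AddCommGroup M] [Module k M] [Module S M]
    (ℳ : ℕ → Submodule k M) : Prop :=
  ∀ ⦃i j s m⦄, s ∈ 𝒮 i → m ∈ ℳ j → s • m ∈ ℳ (i + j)

/-! ### Graded free modules and the ideal `S_+`. -/

section Free

variable {k : Type*} [Field k] {S : Type*} [CommRing S] [Algebra k S]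
  {𝒮 : ℕ → Submodule k S} {ι : Type*}

/-- The degree `j` component of the graded free module with basis `ι` and shifts `a`. -/
def basisPart (𝒮 : ℕ → Submodule k S) (a : ι → ℕ) (j : ℕ) : Submodule k (ι → S) :=
  Submodule.pi Set.univ fun b => twist 𝒮 (a b) j

/-- The submodule `S_+ F` of the free module `F = S^ι`. -/
def basisIrrelevant (𝒮 : ℕ → Submodule k S) (ι : Type*) : Submodule S (ι → S) :=
  Submodule.pi Set.univ fun _ => irrelevantIdeal 𝒮

theorem mem_basisPart {a : ι → ℕ} {j : ℕ} {x : ι → S} :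
    x ∈ basisPart 𝒮 a j ↔ ∀ b, x b ∈ twist 𝒮 (a b) j := by
  simp [basisPart, Submodule.mem_pi]

theorem mem_basisIrrelevant {x : ι → S} :
    x ∈ basisIrrelevant 𝒮 ι ↔ ∀ b, x b ∈ irrelevantIdeal 𝒮 := by
  simp [basisIrrelevant, Submodule.mem_pi]

theorem twist_of_le {a j : ℕ} (h : a ≤ j) : twist 𝒮 a j = 𝒮 (j - a) := if_pos h

theorem twist_of_lt {a j : ℕ} (h : j < a) : twist 𝒮 a j = ⊥ := if_neg (by omega)

theorem twist_add_one (a j : ℕ) : twist 𝒮 (a + 1) (j + 1) = twist 𝒮 a j := by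
  simp [twist]

theorem mem_irrelevantIdeal_of_lt {a j : ℕ} (h : a < j) {s : S} (hs : s ∈ twist 𝒮 a j) :
    s ∈ irrelevantIdeal 𝒮 := by
  rw [twist_of_le h.le] at hs
  exact Ideal.subset_span ⟨_, by omega, hs⟩

theorem mem_basisIrrelevant_of_lt {a : ι → ℕ} {j : ℕ} (h : ∀ b, a b < j) {x : ι → S}
    (hx : x ∈ basisPart 𝒮 a j) : x ∈ basisIrrelevant 𝒮 ι :=
  mem_basisIrrelevant.2 fun b => mem_irrelevantIdeal_of_lt (h b) (mem_basisPart.1 hx b)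

/-- Linear maps send `S_+ F` into `S_+ F'`. -/
theorem map_mem_basisIrrelevant [Fintype ι] {ι' : Type*} (f : (ι → S) →ₗ[S] (ι' → S))
    {x : ι → S} (hx : x ∈ basisIrrelevant 𝒮 ι) : f x ∈ basisIrrelevant 𝒮 ι' := by
  classical
  rw [mem_basisIrrelevant] at hx
  rw [pi_eq_sum_univ' x, map_sum]
  refine Submodule.sum_mem _ fun b _ => ?_
  rw [map_smul, mem_basisIrrelevant]
  intro c
  exact Ideal.mul_mem_right _ _ (hx b)

theorem twist_smul {M : Type*} [AddCommGroup M] [Module k M] [Module S M]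
    {ℳ : ℕ → Submodule k M} (hM : IsGradedSMul 𝒮 ℳ) {a j : ℕ} {s : S} {m : M}
    (hs : s ∈ twist 𝒮 a j) (hm : m ∈ ℳ a) : s • m ∈ ℳ j := by
  by_cases h : a ≤ j
  · rw [twist_of_le h] at hs
    have := hM hs hm
    rwa [Nat.sub_add_cancel h] at this
  · rw [twist_of_lt (by omega), Submodule.mem_bot] at hs
    simp [hs]

/-- The map out of a graded free module given by homogeneous images of the basis is homogeneous. -/
theorem linearCombination_mem [Fintype ι] {M : Type*} [AddCommGroup M] [Module k M] [Module S M]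
    {ℳ : ℕ → Submodule k M} (hM : IsGradedSMul 𝒮 ℳ) {a : ι → ℕ} {g : ι → M}
    (hg : ∀ b, g b ∈ ℳ (a b)) {j : ℕ} {x : ι → S} (hx : x ∈ basisPart 𝒮 a j) :
    Fintype.linearCombination S g x ∈ ℳ j := by
  rw [Fintype.linearCombination_apply]
  exact Submodule.sum_mem _ fun b _ => twist_smul hM (mem_basisPart.1 hx b) (hg b)

variable (hS : ConnectedGrading 𝒮)

include hS

namespace ConnectedGrading

theorem one_mem : (1 : S) ∈ 𝒮 0 := by simpa using hS.algebraMap_mem 1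

theorem twist_self {a : ℕ} : (1 : S) ∈ twist 𝒮 a a := by
  rw [twist_of_le le_rfl, Nat.sub_self]; exact hS.one_mem

theorem smul_twist {a i j : ℕ} {s t : S} (hs : s ∈ 𝒮 i) (ht : t ∈ twist 𝒮 a j) :
    s * t ∈ twist 𝒮 a (i + j) := by
  by_cases h : a ≤ j
  · rw [twist_of_le h] at ht
    rw [twist_of_le (by omega), Nat.add_sub_assoc h]
    exact hS.mul_mem hs ht
  · rw [twist_of_lt (by omega), Submodule.mem_bot] at ht
    simp [ht]

theorem gradedSMul_basisPart (a : ι → ℕ) : IsGradedSMul 𝒮 (basisPart 𝒮 a) := by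
  intro i j s m hs hm
  rw [mem_basisPart] at hm ⊢
  exact fun b => hS.smul_twist hs (hm b)

theorem single_mem [DecidableEq ι] (a : ι → ℕ) (b : ι) :
    (Pi.single b 1 : ι → S) ∈ basisPart 𝒮 a (a b) := by
  rw [mem_basisPart]
  intro c
  by_cases h : c = b
  · subst h; simpa using hS.twist_self
  · rw [Pi.single_eq_of_ne h]; exact Submodule.zero_mem _

/-- The projections of a graded free module of finite rank. -/
def freeProj [Fintype ι] (a : ι → ℕ) : Projections (basisPart 𝒮 a) where
  proj j :=
    { toFun := fun x b => if a b ≤ j then hS.proj (j - a b) (x b) else 0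
      map_add' := by
        intro x y; funext b; by_cases h : a b ≤ j <;> simp [h]
      map_smul' := by
        intro c x; funext b; by_cases h : a b ≤ j <;> simp [h] }
  proj_mem j m := by
    rw [mem_basisPart]
    intro b
    by_cases h : a b ≤ j
    · simpa [h, twist_of_le h] using hS.proj_mem _ _
    · simp [h]
  proj_self := by
    intro j m hm
    rw [mem_basisPart] at hm
    funext b
    have := hm b
    by_cases h : a b ≤ j
    · rw [twist_of_le h] at this
      simp [h, hS.proj_self this]
    · rw [twist_of_lt (by omega), Submodule.mem_bot] at this
      simp [h, this]
  proj_ne := by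
    intro i j m hm hij
    rw [mem_basisPart] at hm
    funext b
    have := hm b
    by_cases h : a b ≤ j
    · simp only [LinearMap.coe_mk, AddHom.coe_mk, h, if_true, Pi.zero_apply]
      by_cases h' : a b ≤ i
      · rw [twist_of_le h'] at this
        exact hS.proj_ne this (by omega)
      · rw [twist_of_lt (by omega), Submodule.mem_bot] at this
        simp [this]
    · simp [h]
  exists_sum := by
    intro m
    choose B hB using fun b => hS.exists_bound (m b)
    refine ⟨Finset.univ.sup fun b => B b + a b, ?_⟩
    funext b
    have hb : B b + a b ≤ Finset.univ.sup fun b => B b + a b :=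
      Finset.le_sup (f := fun b => B b + a b) (Finset.mem_univ b)
    obtain ⟨c, hc⟩ := Nat.exists_eq_add_of_le hb
    rw [Finset.sum_apply, hc]
    simp only [LinearMap.coe_mk, AddHom.coe_mk]
    rw [show B b + a b + c = a b + (B b + c) by ring, Finset.sum_range_add]
    rw [Finset.sum_eq_zero, zero_add]
    · rw [← hS.sum_of_bound (m := m b) (N := B b + c) fun j hj => hB b j (by omega)]
      refine Finset.sum_congr rfl fun x _ => ?_
      simp [hS.sum_of_bound (m := m b) (N := B b + c) fun j hj => hB b j (by omega)]
    · intro x hx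
      have := Finset.mem_range.1 hx
      rw [if_neg (by omega)]

/-- A homogeneous map out of a graded free module lifts along a homogeneous map through which
its values factor. -/
theorem exists_lift [Fintype ι] {N M : Type*}
    [AddCommGroup M] [Module k M] [Module S M] {ℳ : ℕ → Submodule k M} (PM : Projections ℳ)
    (hM : IsGradedSMul 𝒮 ℳ) [AddCommGroup N] [Module k N] [Module S N] {𝒩 : ℕ → Submodule k N}
    (PN : Projections 𝒩) {a : ι → ℕ} (g : M →ₗ[S] N) (hg : ∀ j, ∀ x ∈ ℳ j, g x ∈ 𝒩 j)
    (f : (ι → S) →ₗ[S] N) (hf : ∀ j, ∀ x ∈ basisPart 𝒮 a j, f x ∈ 𝒩 j)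
    (h : ∀ x, ∃ y, g y = f x) :
    ∃ l : (ι → S) →ₗ[S] M, (∀ j, ∀ x ∈ basisPart 𝒮 a j, l x ∈ ℳ j) ∧ ∀ x, g (l x) = f x := by
  classical
  have h1 : ∀ b, ∃ y ∈ ℳ (a b), g y = f (Pi.single b 1) := fun b =>
    PM.exists_homogeneous_lift PN g.toAddMonoidHom hg (hf _ _ (hS.single_mem a b)) (h _)
  choose y hy hgy using h1
  refine ⟨Fintype.linearCombination S y, fun j x hx => linearCombination_mem hM hy hx, ?_⟩
  intro x
  have : g ∘ₗ Fintype.linearCombination S y = f := by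
    refine (Pi.basisFun S ι).ext fun b => ?_
    simp [Fintype.linearCombination_apply_single, hgy]
  exact LinearMap.congr_fun this x

/-- Products involving a component of positive degree do not reach degree zero. Projection to degree
zero is therefore the augmentation `S → k`; its kernel contains `S_+`, which is why `S_+` is proper.
-/
theorem proj_zero_mul (s t : S) : hS.proj 0 (s * t) = hS.proj 0 s * hS.proj 0 t := by
  induction s using hS.induction with
  | hz => simp
  | ha x y hx hy => simp [add_mul, hx, hy]
  | h i x hx =>
    induction t using hS.induction with
    | hz => simp
    | ha x y hx hy => simp [mul_add, hx, hy]
    | h j y hy =>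
      have hxy := hS.mul_mem hx hy
      rcases Nat.eq_zero_or_pos i with rfl | hi
      · rcases Nat.eq_zero_or_pos j with rfl | hj
        · rw [hS.proj_self hx, hS.proj_self hy, hS.proj_self hxy]
        · rw [hS.proj_ne hy (by omega), hS.proj_ne hxy (by omega), mul_zero]
      · rw [hS.proj_ne hx (by omega), hS.proj_ne hxy (by omega), zero_mul]

theorem proj_zero_of_mem_irrelevantIdeal {s : S} (hs : s ∈ irrelevantIdeal 𝒮) :
    hS.proj 0 s = 0 := by
  refine Submodule.span_induction (p := fun s _ => hS.proj 0 s = 0) ?_ (by simp) ?_ ?_ hs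
  · rintro x ⟨j, hj, hx⟩
    exact hS.proj_ne hx (by omega)
  · intro x y _ _ hx hy
    simp [hx, hy]
  · intro c x _ hx
    rw [smul_eq_mul, hS.proj_zero_mul, hx, mul_zero]

theorem one_notMem_irrelevantIdeal [Nontrivial S] : (1 : S) ∉ irrelevantIdeal 𝒮 := fun h => by
  have := hS.proj_zero_of_mem_irrelevantIdeal h
  rw [hS.proj_self hS.one_mem] at this
  exact one_ne_zero this

theorem eq_zero_of_mem_irrelevantIdeal {s : S} (hs : s ∈ irrelevantIdeal 𝒮) (h : s ∈ 𝒮 0) :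
    s = 0 := by
  rw [← hS.proj_self h, hS.proj_zero_of_mem_irrelevantIdeal hs]

theorem single_notMem [Nontrivial S] [DecidableEq ι] (b : ι) :
    (Pi.single b 1 : ι → S) ∉ basisIrrelevant 𝒮 ι := fun h => by
  have := mem_basisIrrelevant.1 h b
  rw [Pi.single_eq_same] at this
  exact hS.one_notMem_irrelevantIdeal this

end ConnectedGrading

end Free

end GradedSyzygies

/-! ### Complexes of graded free modules, and independence of Tor from the resolution. -/

namespace GradedSyzygies

/-- A complex of finite graded free modules, exact in positive homological degrees. -/
structure GradedComplex {k : Type*} [Field k] {S : Type*} [CommRing S] [Algebra k S]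
    (𝒮 : ℕ → Submodule k S) where
  ι : ℕ → Type
  fin : ∀ i, Fintype (ι i)
  dec : ∀ i, DecidableEq (ι i)
  shift : ∀ i, ι i → ℕ
  d : ∀ i, (ι (i + 1) → S) →ₗ[S] (ι i → S)
  d_mem : ∀ i j, ∀ v ∈ basisPart 𝒮 (shift (i + 1)) j, d i v ∈ basisPart 𝒮 (shift i) j
  exact : ∀ i, Function.Exact (d (i + 1)) (d i)

attribute [instance] GradedComplex.fin GradedComplex.dec

/-- A graded free resolution with arbitrary finite bases. -/
structure FreeRes {k : Type*} [Field k] {S : Type*} [CommRing S] [Algebra k S]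
    (𝒮 : ℕ → Submodule k S) {M : Type*} [AddCommGroup M] [Module k M] [Module S M]
    (ℳ : ℕ → Submodule k M) extends GradedComplex 𝒮 where
  ε : (ι 0 → S) →ₗ[S] M
  ε_mem : ∀ j, ∀ v ∈ basisPart 𝒮 (shift 0) j, ε v ∈ ℳ j
  ε_surjective : Function.Surjective ε
  exact_zero : Function.Exact (d 0) ε

namespace GradedComplex

variable {k : Type*} [Field k] {S : Type*} [CommRing S] [Algebra k S] {𝒮 : ℕ → Submodule k S}
  (A B : GradedComplex 𝒮)

abbrev part (i j : ℕ) : Submodule k (A.ι i → S) := basisPart 𝒮 (A.shift i) j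

/-- Representatives of cycles of `A ⊗ S/S_+`. -/
def IsCycle : ∀ i, (A.ι i → S) → Prop
  | 0, _ => True
  | i + 1, z => A.d i z ∈ basisIrrelevant 𝒮 (A.ι i)

/-- Vanishing of the degree `j` part of the `i`-th homology of `A ⊗ S/S_+`. -/
def TorVanishes (i j : ℕ) : Prop :=
  ∀ z ∈ A.part i j, A.IsCycle i z → ∃ y ∈ A.part (i + 1) j, z - A.d i y ∈ basisIrrelevant 𝒮 (A.ι i)

/-- Minimality: the differentials have image in `S_+ A`. -/
def IsMinimal : Prop := ∀ i v, A.d i v ∈ basisIrrelevant 𝒮 (A.ι i)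

variable {A} in
-- Above the degrees of all generators every element already lies in `S_+ A`, so nothing is left
-- after tensoring with `k`.
theorem torVanishes_of_shift_lt {i j : ℕ} (h : ∀ b, A.shift i b < j) : A.TorVanishes i j :=
  fun z hz _ => ⟨0, Submodule.zero_mem _, by
    rw [map_zero, sub_zero]; exact mem_basisIrrelevant_of_lt h hz⟩

/-- Chain maps of degree zero. -/
structure Hom where
  f : ∀ i, (A.ι i → S) →ₗ[S] (B.ι i → S)
  f_mem : ∀ i j, ∀ x ∈ A.part i j, f i x ∈ B.part i j
  comm : ∀ i x, B.d i (f (i + 1) x) = f i (A.d i x)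

/-- The complex with all shifts raised by one. -/
@[reducible] def shiftOne : GradedComplex 𝒮 where
  ι := A.ι
  fin := A.fin
  dec := A.dec
  shift i b := A.shift i b + 1
  d := A.d
  exact := A.exact
  d_mem i j x hx := by
    rw [mem_basisPart] at hx ⊢
    rcases j with _ | j
    · have : x = 0 := by
        funext b
        have := hx b
        rwa [twist_of_lt (by omega), Submodule.mem_bot] at this
      simp [this]
    · intro b
      rw [twist_add_one]
      refine mem_basisPart.1 (A.d_mem i j x (mem_basisPart.2 fun b => ?_)) b
      have := hx b
      rwa [twist_add_one] at this

end GradedComplex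

namespace FreeRes

variable {k : Type*} [Field k] {S : Type*} [CommRing S] [Algebra k S] {𝒮 : ℕ → Submodule k S}
  (hS : ConnectedGrading 𝒮) {M : Type*} [AddCommGroup M] [Module k M] [Module S M]
  {ℳ : ℕ → Submodule k M} (PM : Projections ℳ) (A : GradedComplex 𝒮) (B F : FreeRes 𝒮 ℳ)

include hS PM in
/-- Lifting of a homogeneous map to a chain map. -/
theorem exists_chainMap (f : (A.ι 0 → S) →ₗ[S] M) (hf : ∀ j, ∀ x ∈ A.part 0 j, f x ∈ ℳ j)
    (hfd : ∀ x, f (A.d 0 x) = 0) :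
    ∃ Φ : A.Hom B.toGradedComplex, ∀ x, B.ε (Φ.f 0 x) = f x := by
  have h0 : ∃ l : (A.ι 0 → S) →ₗ[S] (B.ι 0 → S),
      (∀ j, ∀ x ∈ A.part 0 j, l x ∈ B.part 0 j) ∧ ∀ x, B.ε (l x) = f x :=
    hS.exists_lift (hS.freeProj _) (hS.gradedSMul_basisPart _) PM B.ε B.ε_mem f hf
      fun x => B.ε_surjective _
  obtain ⟨l₀, hl₀, hε⟩ := h0
  -- The recursion carries, along with the lift, the fact that its composite with `A.d i` lands in
  -- the image of `B.d i`; this is exactly what the next lift needs.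
  let X (i : ℕ) := {l : (A.ι i → S) →ₗ[S] (B.ι i → S) //
    (∀ j, ∀ x ∈ A.part i j, l x ∈ B.part i j) ∧ ∀ x, ∃ y, B.d i y = l (A.d i x)}
  have step (i : ℕ) (l : X i) : ∃ l' : X (i + 1), ∀ x, B.d i (l'.1 x) = l.1 (A.d i x) := by
    obtain ⟨l, hl, hld⟩ := l
    obtain ⟨l', hl', h⟩ := hS.exists_lift (hS.freeProj _) (hS.gradedSMul_basisPart _)
      (hS.freeProj _) (B.d i) (B.d_mem i) (l ∘ₗ A.d i)
      (fun j x hx => hl j _ (A.d_mem i j x hx)) hld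
    refine ⟨⟨l', hl', fun x => ?_⟩, h⟩
    refine (B.exact i _).1 ?_
    rw [h, LinearMap.comp_apply, (A.exact i).apply_apply_eq_zero, map_zero]
  choose next hnext using step
  let x₀ : X 0 := ⟨l₀, hl₀, fun x => (B.exact_zero _).1 (by rw [hε, hfd])⟩
  let F (i : ℕ) : X i := Nat.rec x₀ next i
  exact ⟨⟨fun i => (F i).1, fun i => (F i).2.1, fun i x => hnext i (F i) x⟩, hε⟩

include hS PM in
/-- Vanishing of graded Tor does not depend on the resolution. -/
theorem torVanishes_of_torVanishes {i j : ℕ} (h : F.TorVanishes i j) : B.TorVanishes i j := by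
  obtain ⟨α, hα⟩ := exists_chainMap hS PM B.toGradedComplex F B.ε B.ε_mem
    B.exact_zero.apply_apply_eq_zero
  obtain ⟨β, hβ⟩ := exists_chainMap hS PM F.toGradedComplex B F.ε F.ε_mem
    F.exact_zero.apply_apply_eq_zero
  -- A homotopy `id = βα + dh + κ`, built degree by degree, where `κ` is the previous homotopy
  -- composed with the differential, and `0` at the start. Only two facts about `κ` are kept: it
  -- kills boundaries, which allows the next step, and it sends cycles modulo `S_+` into `S_+`,
  -- which makes it invisible in Tor.
  have key : ∀ i, ∃ (h : (B.ι i → S) →ₗ[S] (B.ι (i + 1) → S)) (κ : (B.ι i → S) →ₗ[S] (B.ι i → S)),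
      (∀ j, ∀ x ∈ B.part i j, h x ∈ B.part (i + 1) j) ∧
      (∀ x, x = β.f i (α.f i x) + B.d i (h x) + κ x) ∧ (∀ x, κ (B.d i x) = 0) ∧
      ∀ z, B.IsCycle i z → κ z ∈ basisIrrelevant 𝒮 (B.ι i) := by
    intro i
    induction i with
    | zero =>
      obtain ⟨l, hl, hl'⟩ := hS.exists_lift (hS.freeProj (B.shift 1)) (hS.gradedSMul_basisPart _)
        (hS.freeProj (B.shift 0)) (B.d 0) (B.d_mem 0) (LinearMap.id - β.f 0 ∘ₗ α.f 0)
        (fun j x hx => Submodule.sub_mem _ hx (β.f_mem 0 j _ (α.f_mem 0 j x hx))) (fun x => by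
          refine (B.exact_zero _).1 ?_
          simp [hα, hβ])
      refine ⟨l, 0, hl, fun x => ?_, fun _ => rfl, fun _ _ => Submodule.zero_mem _⟩
      rw [hl' x]
      simp
    | succ i ih =>
      obtain ⟨h, κ, hh, hd, hκ, -⟩ := ih
      obtain ⟨l, hl, hl'⟩ := hS.exists_lift (hS.freeProj (B.shift (i + 2)))
        (hS.gradedSMul_basisPart _)
        (hS.freeProj (B.shift (i + 1))) (B.d (i + 1)) (B.d_mem (i + 1))
        (LinearMap.id - β.f (i + 1) ∘ₗ α.f (i + 1) - h ∘ₗ B.d i)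
        (fun j x hx => Submodule.sub_mem _
          (Submodule.sub_mem _ hx (β.f_mem _ j _ (α.f_mem _ j x hx))) (hh _ _ (B.d_mem _ _ _ hx)))
        (fun x => by
          refine (B.exact i _).1 ?_
          have := hd (B.d i x)
          rw [hκ] at this
          simp only [LinearMap.sub_apply, LinearMap.id_apply, LinearMap.comp_apply, map_sub,
            β.comm, α.comm]
          nth_rewrite 1 [this]
          abel)
      refine ⟨l, h ∘ₗ B.d i, hl, fun x => ?_, fun x => ?_, fun z hz => ?_⟩
      · rw [hl' x]
        simp only [LinearMap.sub_apply, LinearMap.id_apply, LinearMap.comp_apply]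
        abel
      · simp [(B.exact i).apply_apply_eq_zero]
      · exact map_mem_basisIrrelevant h hz
  intro z hz hc
  obtain ⟨l, κ, hl, hd, -, hκ⟩ := key i
  obtain ⟨y, hy, hzy⟩ := h (α.f i z) (α.f_mem i j z hz) (by
    cases i with
    | zero => trivial
    | succ i =>
      change F.d i (α.f (i + 1) z) ∈ _
      rw [α.comm]
      exact map_mem_basisIrrelevant (α.f i) hc)
  refine ⟨β.f (i + 1) y + l z, Submodule.add_mem _ (β.f_mem _ _ _ hy) (hl _ _ hz), ?_⟩
  have h2 : z - B.d i (β.f (i + 1) y + l z) = β.f i (α.f i z - F.d i y) + κ z := by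
    nth_rewrite 1 [hd z]
    rw [map_add, β.comm, map_sub]
    abel
  rw [h2]
  exact Submodule.add_mem _ (map_mem_basisIrrelevant _ hzy) (hκ z hc)

end FreeRes

/-- A graded free resolution, forgetting that its bases are indexed by `Fin`. -/
def GradedFreeResolution.toFreeRes {k : Type*} [Field k] {S : Type*} [CommRing S] [Algebra k S]
    {𝒮 : ℕ → Submodule k S} {M : Type*} [AddCommGroup M] [Module k M] [Module S M]
    {ℳ : ℕ → Submodule k M} (F : GradedFreeResolution 𝒮 ℳ) : FreeRes 𝒮 ℳ where
  ι i := Fin (F.rank i)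
  fin _ := inferInstance
  dec _ := inferInstance
  shift := F.shift
  d := F.d
  d_mem := F.d_homogeneous
  exact := F.exact_succ
  ε := F.ε
  ε_mem := F.ε_homogeneous
  ε_surjective := F.ε_surjective
  exact_zero := F.exact_zero

theorem GradedFreeResolution.torVanishes {k : Type*} [Field k] {S : Type*} [CommRing S]
    [Algebra k S]
    {𝒮 : ℕ → Submodule k S} {M : Type*} [AddCommGroup M] [Module k M] [Module S M]
    {ℳ : ℕ → Submodule k M} (F : GradedFreeResolution 𝒮 ℳ) {i j : ℕ}
    (h : Subsingleton (F.Tor i j)) : F.toFreeRes.TorVanishes i j := by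
  intro (z : Fin (F.rank i) → S) hz hc
  rw [Submodule.Quotient.subsingleton_iff] at h
  have hzc : z ∈ F.cycles i j := by
    cases i with
    | zero => exact hz
    | succ i => exact ⟨hz, hc⟩
  have hb : z ∈ F.boundaries i j := by
    have : (⟨z, hzc⟩ : F.cycles i j) ∈ (F.boundaries i j).submoduleOf (F.cycles i j) := by
      rw [h]; trivial
    exact this
  obtain ⟨a, ha, b, ⟨y, hy, rfl⟩, hab⟩ := Submodule.mem_sup.1 hb
  refine ⟨y, hy, ?_⟩
  have hz' : z - F.d i y = a := by rw [← hab]; exact add_sub_cancel_right _ _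
  change z - F.d i y ∈ _
  rw [hz']
  exact ha.2

end GradedSyzygies

/-! ### Mapping cones. -/

namespace GradedSyzygies

namespace GradedComplex

variable {k : Type*} [Field k] {S : Type*} [CommRing S] [Algebra k S] {𝒮 : ℕ → Submodule k S}

section Cone

variable {A B : GradedComplex 𝒮} (Φ : A.Hom B)

/-- Bases of the mapping cone. -/
def coneIndex (A B : GradedComplex 𝒮) : ℕ → Type
  | 0 => B.ι 0
  | i + 1 => B.ι (i + 1) ⊕ A.ι i

/-- Shifts of the mapping cone. -/
def coneShift (A B : GradedComplex 𝒮) : ∀ i, coneIndex A B i → ℕ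
  | 0 => B.shift 0
  | i + 1 => Sum.elim (B.shift (i + 1)) (A.shift i)

/-- The linear map `(b, a) ↦ (f b + g a, -h a)` in coordinates. -/
def coneMap {α β γ δ : Type*} (f : (α → S) →ₗ[S] (γ → S)) (g : (β → S) →ₗ[S] (γ → S))
    (h : (β → S) →ₗ[S] (δ → S)) : (α ⊕ β → S) →ₗ[S] (γ ⊕ δ → S) where
  toFun x := Sum.elim (f (x ∘ Sum.inl) + g (x ∘ Sum.inr)) (-h (x ∘ Sum.inr))
  map_add' x y := by
    have h1 : (x + y) ∘ Sum.inl = x ∘ (Sum.inl : α → α ⊕ β) + y ∘ Sum.inl := rfl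
    have h2 : (x + y) ∘ Sum.inr = x ∘ (Sum.inr : β → α ⊕ β) + y ∘ Sum.inr := rfl
    funext c
    rw [h1, h2, map_add, map_add, map_add]
    rcases c with c | c <;> simp <;> ring
  map_smul' s x := by
    have h1 : (s • x) ∘ Sum.inl = s • x ∘ (Sum.inl : α → α ⊕ β) := rfl
    have h2 : (s • x) ∘ Sum.inr = s • x ∘ (Sum.inr : β → α ⊕ β) := rfl
    funext c
    rw [h1, h2, map_smul, map_smul, map_smul]
    rcases c with c | c <;> simp; ring

theorem coneMap_apply {α β γ δ : Type*} (f : (α → S) →ₗ[S] (γ → S)) (g : (β → S) →ₗ[S] (γ → S))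
    (h : (β → S) →ₗ[S] (δ → S)) (x : α ⊕ β → S) :
    coneMap f g h x = Sum.elim (f (x ∘ Sum.inl) + g (x ∘ Sum.inr)) (-h (x ∘ Sum.inr)) := rfl

/-- Differentials of the mapping cone. -/
def coneD : ∀ i, (coneIndex A B (i + 1) → S) →ₗ[S] (coneIndex A B i → S)
  | 0 => B.d 0 ∘ₗ LinearMap.funLeft S S Sum.inl + Φ.f 0 ∘ₗ LinearMap.funLeft S S Sum.inr
  | i + 1 => coneMap (B.d (i + 1)) (Φ.f (i + 1)) (A.d i)

theorem mem_basisPart_sum {α β : Type*} {a : α → ℕ} {b : β → ℕ} {j : ℕ} {x : α ⊕ β → S} :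
    x ∈ basisPart 𝒮 (Sum.elim a b) j ↔
      x ∘ Sum.inl ∈ basisPart 𝒮 a j ∧ x ∘ Sum.inr ∈ basisPart 𝒮 b j := by
  simp [mem_basisPart]

theorem mem_basisIrrelevant_sum {α β : Type*} {x : α ⊕ β → S} :
    x ∈ basisIrrelevant 𝒮 (α ⊕ β) ↔
      x ∘ Sum.inl ∈ basisIrrelevant 𝒮 α ∧ x ∘ Sum.inr ∈ basisIrrelevant 𝒮 β := by
  simp [mem_basisIrrelevant]

theorem cone_lift (i : ℕ) (y : B.ι (i + 1) → S) (a : A.ι (i + 1) → S)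
    (h : B.d i y + Φ.f i (A.d i a) = 0) : ∃ z, B.d (i + 1) z = y + Φ.f (i + 1) a := by
  refine (B.exact i _).1 ?_
  rw [map_add, Φ.comm, h]

/-- For a cycle `(b, a)` the class of `a` dies in `H_0(B)`, so injectivity on `H_0` makes `a` a
boundary. Correcting by that boundary turns the `B`-component into a cycle of `B`, hence a boundary.
-/
theorem cone_exact_zero (hΦ : ∀ x, (∃ y, B.d 0 y = Φ.f 0 x) → ∃ y, A.d 0 y = x) :
    Function.Exact (coneMap (B.d 1) (Φ.f 1) (A.d 0))
      (B.d 0 ∘ₗ LinearMap.funLeft S S Sum.inl + Φ.f 0 ∘ₗ LinearMap.funLeft S S Sum.inr :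
        (B.ι 1 ⊕ A.ι 0 → S) →ₗ[S] (B.ι 0 → S)) := by
  intro x
  change B.d 0 (x ∘ Sum.inl) + Φ.f 0 (x ∘ Sum.inr) = 0 ↔ _
  constructor
  · intro h
    obtain ⟨a, ha⟩ := hΦ (x ∘ Sum.inr) ⟨-(x ∘ Sum.inl), by
      rw [map_neg]; exact (eq_neg_of_add_eq_zero_right h).symm⟩
    obtain ⟨z, hz⟩ := cone_lift Φ 0 (x ∘ Sum.inl) a (by rw [ha, h])
    refine ⟨Sum.elim z (-a), ?_⟩
    rw [coneMap_apply]
    funext c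
    rcases c with c | c
    · simp [hz]
    · simp [ha]
  · rintro ⟨y, rfl⟩
    rw [coneMap_apply, Sum.elim_comp_inl, Sum.elim_comp_inr]
    rw [map_add, (B.exact 0).apply_apply_eq_zero, Φ.comm, map_neg]
    simp

theorem cone_exact_succ (i : ℕ) :
    Function.Exact (coneMap (B.d (i + 2)) (Φ.f (i + 2)) (A.d (i + 1)))
      (coneMap (B.d (i + 1)) (Φ.f (i + 1)) (A.d i)) := by
  intro x
  rw [coneMap_apply]
  constructor
  · intro h
    have h1 : B.d (i + 1) (x ∘ Sum.inl) + Φ.f (i + 1) (x ∘ Sum.inr) = 0 :=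
      funext fun c => congrFun h (Sum.inl c)
    have h2 : A.d i (x ∘ Sum.inr) = 0 := funext fun c => by
      simpa using congrFun h (Sum.inr c)
    obtain ⟨a, ha⟩ := (A.exact i _).1 h2
    obtain ⟨z, hz⟩ := cone_lift Φ (i + 1) (x ∘ Sum.inl) a (by rw [ha, h1])
    refine ⟨Sum.elim z (-a), ?_⟩
    rw [coneMap_apply]
    funext c
    rcases c with c | c
    · simp [hz]
    · simp [ha]
  · rintro ⟨y, rfl⟩
    rw [coneMap_apply, Sum.elim_comp_inl, Sum.elim_comp_inr]
    funext c
    rcases c with c | c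
    · simp [(B.exact (i + 1)).apply_apply_eq_zero, Φ.comm]
    · simp [(A.exact i).apply_apply_eq_zero]

/-- The mapping cone of a chain map that is injective on zeroth homology. -/
def cone (hΦ : ∀ x, (∃ y, B.d 0 y = Φ.f 0 x) → ∃ y, A.d 0 y = x) : GradedComplex 𝒮 where
  ι := coneIndex A B
  fin i := match i with
    | 0 => B.fin 0
    | _ + 1 => inferInstanceAs (Fintype (_ ⊕ _))
  dec i := match i with
    | 0 => B.dec 0
    | _ + 1 => inferInstanceAs (DecidableEq (_ ⊕ _))
  shift := coneShift A B
  d := coneD Φ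
  d_mem i j v hv := by
    have hv' := mem_basisPart_sum.1 hv
    cases i with
    | zero => exact Submodule.add_mem _ (B.d_mem _ _ _ hv'.1) (Φ.f_mem _ _ _ hv'.2)
    | succ i =>
      refine mem_basisPart_sum.2 ⟨?_, ?_⟩
      · exact Submodule.add_mem _ (B.d_mem _ _ _ hv'.1) (Φ.f_mem _ _ _ hv'.2)
      · exact Submodule.neg_mem _ (A.d_mem _ _ _ hv'.2)
  exact i := match i with
    | 0 => cone_exact_zero Φ hΦ
    | i + 1 => cone_exact_succ Φ i

end Cone

end GradedComplex

/-- The mapping cone as a free resolution. -/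
def FreeRes.ofCone {k : Type*} [Field k] {S : Type*} [CommRing S] [Algebra k S]
    {𝒮 : ℕ → Submodule k S} {M : Type*} [AddCommGroup M] [Module k M] [Module S M]
    {ℳ : ℕ → Submodule k M} {A B : GradedComplex 𝒮} (Φ : A.Hom B)
    (hΦ : ∀ x, (∃ y, B.d 0 y = Φ.f 0 x) → ∃ y, A.d 0 y = x)
    (ε : (B.ι 0 → S) →ₗ[S] M) (ε_mem : ∀ j, ∀ v ∈ B.part 0 j, ε v ∈ ℳ j)
    (ε_surjective : Function.Surjective ε)
    (hd : ∀ x, ε (B.d 0 x) = 0) (hf : ∀ x, ε (Φ.f 0 x) = 0)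
    (hε : ∀ x, ε x = 0 → ∃ y z, B.d 0 y + Φ.f 0 z = x) : FreeRes 𝒮 ℳ where
  toGradedComplex := GradedComplex.cone Φ hΦ
  ε := ε
  ε_mem := ε_mem
  ε_surjective := ε_surjective
  exact_zero x := by
    constructor
    · intro h
      obtain ⟨y, z, rfl⟩ := hε x h
      exact ⟨Sum.elim y z, rfl⟩
    · rintro ⟨y, rfl⟩
      change ε (B.d 0 (y ∘ Sum.inl) + Φ.f 0 (y ∘ Sum.inr)) = 0
      rw [map_add, hd, hf, add_zero]

end GradedSyzygies

/-! ### Extension of scalars along `S → S[u]`. -/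

namespace GradedSyzygies

theorem basisPart_map_mem {k : Type*} [Field k] {S : Type*} [CommRing S] [Algebra k S]
    {𝒮 : ℕ → Submodule k S} {ι : Type*} [Fintype ι] [DecidableEq ι]
    {M : Type*} [AddCommGroup M] [Module k M] [Module S M]
    {ℳ : ℕ → Submodule k M} (hM : IsGradedSMul 𝒮 ℳ) {a : ι → ℕ} (f : (ι → S) →ₗ[S] M)
    (hf : ∀ b, f (Pi.single b 1) ∈ ℳ (a b)) {j : ℕ} {x : ι → S} (hx : x ∈ basisPart 𝒮 a j) :
    f x ∈ ℳ j := by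
  have : f = Fintype.linearCombination S fun b => f (Pi.single b 1) :=
    (Pi.basisFun S ι).ext fun b => by simp [Fintype.linearCombination_apply_single]
  rw [this]
  exact linearCombination_mem hM hf hx

section PolynomialExtension

open Polynomial

variable {S T : Type*} [CommRing S] [CommRing T] [Algebra S T] {ι ι' ι'' : Type*}

/-- The inclusion `S^ι → T^ι`. -/
def freeIncl (S T : Type*) [CommRing S] [CommRing T] [Algebra S T] (ι : Type*) :
    (ι → S) →ₗ[S] (ι → T) :=
  (Algebra.linearMap S T).compLeft ι

@[simp] theorem freeIncl_apply (x : ι → S) (b : ι) :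
    freeIncl S T ι x b = algebraMap S T (x b) := rfl

theorem freeIncl_single [DecidableEq ι] (b : ι) :
    freeIncl S T ι (Pi.single b 1) = Pi.single b 1 := by
  funext c
  by_cases h : c = b
  · subst h; simp
  · simp [h]

/-- Extension of scalars of a map of free modules. -/
def freeExt (T : Type*) [CommRing T] [Algebra S T] [Fintype ι] [DecidableEq ι]
    (f : (ι → S) →ₗ[S] (ι' → S)) : (ι → T) →ₗ[T] (ι' → T) :=
  Fintype.linearCombination T fun b => freeIncl S T ι' (f (Pi.single b 1))

variable [Fintype ι] [DecidableEq ι]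

theorem freeExt_single (f : (ι → S) →ₗ[S] (ι' → S)) (b : ι) :
    freeExt T f (Pi.single b 1) = freeIncl S T ι' (f (Pi.single b 1)) := by
  simp [freeExt, Fintype.linearCombination_apply_single]

theorem freeExt_freeIncl (f : (ι → S) →ₗ[S] (ι' → S)) (x : ι → S) :
    freeExt T f (freeIncl S T ι x) = freeIncl S T ι' (f x) := by
  have : (freeExt T f).restrictScalars S ∘ₗ freeIncl S T ι = freeIncl S T ι' ∘ₗ f :=
    (Pi.basisFun S ι).ext fun b => by simp [freeIncl_single, freeExt_single]
  exact LinearMap.congr_fun this x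

theorem freeExt_comp [Fintype ι'] [DecidableEq ι'] (f : (ι → S) →ₗ[S] (ι' → S))
    (g : (ι' → S) →ₗ[S] (ι'' → S)) (x : ι → T) :
    freeExt T g (freeExt T f x) = freeExt T (g ∘ₗ f) x := by
  have : freeExt T g ∘ₗ freeExt T f = freeExt T (g ∘ₗ f) :=
    (Pi.basisFun T ι).ext fun b => by simp [freeExt_single, freeExt_freeIncl]
  exact LinearMap.congr_fun this x

theorem freeExt_zero (x : ι → T) : freeExt T (0 : (ι → S) →ₗ[S] (ι' → S)) x = 0 := by
  have : freeExt T (0 : (ι → S) →ₗ[S] (ι' → S)) = 0 :=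
    (Pi.basisFun T ι).ext fun b => by simp [freeExt_single]
  rw [this]; rfl

variable (θ : S[X] ≃ₐ[S] T)

omit [Fintype ι] [DecidableEq ι] in
/-- Coefficients of a vector over `T = S[u]`. -/
def freeCoeff (ι : Type*) (n : ℕ) : (ι → T) →ₗ[S] (ι → S) :=
  (lcoeff S n ∘ₗ θ.symm.toLinearMap).compLeft ι

omit [Fintype ι] [DecidableEq ι] in
theorem freeCoeff_apply (n : ℕ) (x : ι → T) (b : ι) :
    freeCoeff θ ι n x b = (θ.symm (x b)).coeff n := rfl

theorem freeCoeff_freeExt (f : (ι → S) →ₗ[S] (ι' → S)) (n : ℕ) (x : ι → T) :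
    freeCoeff θ ι' n (freeExt T f x) = f (freeCoeff θ ι n x) := by
  funext c
  rw [freeCoeff_apply, freeExt, Fintype.linearCombination_apply, Finset.sum_apply, map_sum,
    finsetSum_coeff, pi_eq_sum_univ' (freeCoeff θ ι n x), map_sum, Finset.sum_apply]
  refine Finset.sum_congr rfl fun b _ => ?_
  rw [map_smul, Pi.smul_apply, Pi.smul_apply, smul_eq_mul, smul_eq_mul, map_mul, freeIncl_apply,
    AlgEquiv.commutes, Polynomial.algebraMap_eq, coeff_mul_C, freeCoeff_apply]

omit [Fintype ι] [DecidableEq ι] in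
theorem freeCoeff_X_smul (n : ℕ) (x : ι → T) :
    freeCoeff θ ι (n + 1) (θ X • x) = freeCoeff θ ι n x := by
  funext c
  simp [freeCoeff_apply, coeff_X_mul]

omit [Fintype ι] [DecidableEq ι] in
theorem freeCoeff_pow_smul (n m : ℕ) (x : ι → S) :
    freeCoeff θ ι n (θ X ^ m • freeIncl S T ι x) = if n = m then x else 0 := by
  funext c
  have : θ.symm (θ X ^ m * algebraMap S T (x c)) = X ^ m * C (x c) := by
    rw [map_mul, AlgEquiv.commutes, map_pow, θ.symm_apply_apply, Polynomial.algebraMap_eq]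
  simp only [freeCoeff_apply, Pi.smul_apply, freeIncl_apply, smul_eq_mul, this, coeff_mul_C,
    coeff_X_pow]
  split_ifs <;> simp

omit [DecidableEq ι] in
theorem freeCoeff_bound (x : ι → T) : ∃ N, ∀ n, N ≤ n → freeCoeff θ ι n x = 0 := by
  refine ⟨Finset.univ.sup fun b => (θ.symm (x b)).natDegree + 1, fun n hn => funext fun b => ?_⟩
  have : (θ.symm (x b)).natDegree + 1 ≤ n :=
    (Finset.le_sup (f := fun b => (θ.symm (x b)).natDegree + 1) (Finset.mem_univ b)).trans hn
  exact coeff_eq_zero_of_natDegree_lt (Nat.lt_of_succ_le this)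

omit [Fintype ι] [DecidableEq ι] in
theorem eq_of_freeCoeff {x y : ι → T} (h : ∀ n, freeCoeff θ ι n x = freeCoeff θ ι n y) :
    x = y := by
  funext b
  apply θ.symm.injective
  ext n
  exact congrFun (h n) b

omit [Fintype ι] [DecidableEq ι] in
theorem eq_sum_freeCoeff {x : ι → T} {N : ℕ} (h : ∀ n, N ≤ n → freeCoeff θ ι n x = 0) :
    x = ∑ n ∈ Finset.range N, θ X ^ n • freeIncl S T ι (freeCoeff θ ι n x) := by
  refine eq_of_freeCoeff θ fun m => ?_
  rw [map_sum]
  simp only [freeCoeff_pow_smul]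
  rw [Finset.sum_ite_eq]
  split_ifs with hm
  · rfl
  · exact h m (by simpa using hm)

include θ in
-- `T` is free over `S` on the powers of `u`, and an extended map acts on each coefficient
-- separately, so exactness can be checked coefficientwise.
theorem freeExt_exact [Fintype ι'] [DecidableEq ι'] {f : (ι → S) →ₗ[S] (ι' → S)}
    {g : (ι' → S) →ₗ[S] (ι'' → S)} (h : Function.Exact f g) :
    Function.Exact (freeExt T f) (freeExt T g) := by
  intro x
  constructor
  · intro hx
    have h1 : ∀ n, ∃ y, f y = freeCoeff θ ι' n x := fun n => by
      refine (h _).1 ?_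
      rw [← freeCoeff_freeExt, hx, map_zero]
    choose y hy using h1
    obtain ⟨N, hN⟩ := freeCoeff_bound θ x
    refine ⟨∑ n ∈ Finset.range N, θ X ^ n • freeIncl S T ι (y n), ?_⟩
    conv_rhs => rw [eq_sum_freeCoeff θ hN]
    rw [map_sum]
    refine Finset.sum_congr rfl fun n _ => ?_
    rw [map_smul, freeExt_freeIncl, hy]
  · rintro ⟨y, rfl⟩
    rw [freeExt_comp, h.linearMap_comp_eq_zero, freeExt_zero]

/-- If `f` covers multiplication by `u` up to the image of `d`, then `u - f` is injective modulo
the image of `d`, where all maps are extended from `S` to `T = S[u]`. -/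
theorem freeExt_sub_injective [Fintype ι'] [DecidableEq ι'] (f : (ι → S) →ₗ[S] (ι → S))
    (d : (ι' → S) →ₗ[S] (ι → S)) (f' : (ι' → S) →ₗ[S] (ι' → S))
    (hd : ∀ x, d (f' x) = f (d x)) (y : ι → T) (w : ι' → T)
    (h : freeExt T d w = θ X • y - freeExt T f y) : ∃ z, freeExt T d z = y := by
  obtain ⟨N, hN⟩ := freeCoeff_bound θ y
  induction N generalizing y w with
  | zero =>
    refine ⟨0, ?_⟩
    rw [map_zero]
    exact eq_of_freeCoeff θ fun n => by rw [map_zero, hN n (Nat.zero_le _)]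
  | succ N ih =>
    -- Here `y` has degree at most `N` in `u`, so the coefficient of `u ^ (N + 1)` in `u y - f y` is
    -- the top coefficient of `y`. That coefficient is thus in the image of `d`, and removing it
    -- lowers the degree.
    have h1 : d (freeCoeff θ ι' (N + 1) w) = freeCoeff θ ι N y := by
      rw [← freeCoeff_freeExt, h, map_sub, freeCoeff_X_smul, freeCoeff_freeExt, hN (N + 1) le_rfl]
      simp
    set v : ι' → T := θ X ^ N • freeIncl S T ι' (freeCoeff θ ι' (N + 1) w) with hv
    have hdv : freeExt T d v = θ X ^ N • freeIncl S T ι (freeCoeff θ ι N y) := by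
      rw [hv, map_smul, freeExt_freeIncl, h1]
    have hcomm : ∀ x, freeExt T f (freeExt T d x) = freeExt T d (freeExt T f' x) := fun x => by
      rw [freeExt_comp, freeExt_comp]
      congr 2
      ext1 x
      ext1
      simp [hd]
    obtain ⟨z, hz⟩ := ih (y - freeExt T d v) (w - (θ X • v - freeExt T f' v)) (by
        rw [map_sub, h, map_sub, map_sub, map_smul, hcomm, smul_sub]
        abel) (fun n hn => by
        rw [map_sub, hdv, freeCoeff_pow_smul]
        rcases eq_or_lt_of_le hn with rfl | hn
        · simp
        · rw [hN n hn, if_neg (by omega), sub_zero])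
    exact ⟨z + v, by rw [map_add, hz, sub_add_cancel]⟩

include θ in
-- Modulo the image of `u - f` one may replace `u` by `f`, so `u ^ n z` is congruent to `f ^ n z`, a
-- vector over `S`. With `freeExt_sub_injective` this computes the zeroth homology of the cone.
theorem exists_sub_add_incl (f : (ι → S) →ₗ[S] (ι → S)) (x : ι → T) :
    ∃ (y : ι → T) (z : ι → S), x = (θ X • y - freeExt T f y) + freeIncl S T ι z := by
  have hadd : ∀ x₁ x₂ : ι → T,
      (∃ (y : ι → T) (z : ι → S), x₁ = (θ X • y - freeExt T f y) + freeIncl S T ι z) →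
      (∃ (y : ι → T) (z : ι → S), x₂ = (θ X • y - freeExt T f y) + freeIncl S T ι z) →
      ∃ (y : ι → T) (z : ι → S), x₁ + x₂ = (θ X • y - freeExt T f y) + freeIncl S T ι z := by
    rintro _ _ ⟨y, z, rfl⟩ ⟨y', z', rfl⟩
    refine ⟨y + y', z + z', ?_⟩
    simp only [smul_add, map_add]
    abel
  have hpow : ∀ n (z : ι → S), ∃ (y : ι → T) (z' : ι → S),
      θ X ^ n • freeIncl S T ι z = (θ X • y - freeExt T f y) + freeIncl S T ι z' := by
    intro n z
    induction n with
    | zero => exact ⟨0, z, by simp⟩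
    | succ n ih =>
      obtain ⟨y, z', h⟩ := ih
      refine ⟨θ X • y + freeIncl S T ι z', f z', ?_⟩
      rw [pow_succ', mul_smul, h, smul_add, smul_sub, smul_add, map_add, map_smul,
        freeExt_freeIncl]
      abel
  obtain ⟨N, hN⟩ := freeCoeff_bound θ x
  rw [eq_sum_freeCoeff θ hN]
  refine Finset.sum_induction _
    (fun x => ∃ (y : ι → T) (z : ι → S), x = (θ X • y - freeExt T f y) + freeIncl S T ι z)
    hadd ⟨0, 0, by simp⟩ fun n _ => hpow n _

end PolynomialExtension

section ScalarExtension

open Polynomial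

variable {k : Type*} [Field k] {S : Type*} [CommRing S] [Algebra k S] {𝒮 : ℕ → Submodule k S}
  {T : Type*} [CommRing T] [Algebra k T] {𝒯 : ℕ → Submodule k T} [Algebra S T]
  (θ : S[X] ≃ₐ[S] T) (hST : ∀ j, ∀ s ∈ 𝒮 j, algebraMap S T s ∈ 𝒯 j)

include hST in
theorem freeIncl_mem {ι : Type*} {a : ι → ℕ} {j : ℕ} {x : ι → S} (hx : x ∈ basisPart 𝒮 a j) :
    freeIncl S T ι x ∈ basisPart 𝒯 a j := by
  rw [mem_basisPart] at hx ⊢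
  intro b
  have := hx b
  by_cases h : a b ≤ j
  · rw [twist_of_le h] at this ⊢
    exact hST _ _ this
  · rw [twist_of_lt (by omega), Submodule.mem_bot] at this
    simp [this]

include hST in
theorem freeIncl_mem_basisIrrelevant {ι : Type*} {x : ι → S} (hx : x ∈ basisIrrelevant 𝒮 ι) :
    freeIncl S T ι x ∈ basisIrrelevant 𝒯 ι := by
  rw [mem_basisIrrelevant] at hx ⊢
  intro b
  have h : irrelevantIdeal 𝒮 ≤ (irrelevantIdeal 𝒯).comap (algebraMap S T) := by
    refine Ideal.span_le.2 ?_
    rintro s ⟨j, hj, hs⟩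
    exact Ideal.subset_span ⟨j, hj, hST j s hs⟩
  exact h (hx b)

/-- Extension of scalars of a complex of graded free modules along `S → T = S[u]`. -/
@[reducible] def GradedComplex.extend (hS : ConnectedGrading 𝒮) (hT : ConnectedGrading 𝒯)
    (A : GradedComplex 𝒮) : GradedComplex 𝒯 where
  ι := A.ι
  fin := A.fin
  dec := A.dec
  shift := A.shift
  d i := freeExt T (A.d i)
  d_mem i j v hv := by
    refine basisPart_map_mem (hT.gradedSMul_basisPart _) _ (fun b => ?_) hv
    rw [freeExt_single]
    exact freeIncl_mem hST (A.d_mem _ _ _ (hS.single_mem _ b))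
  exact i := freeExt_exact θ (A.exact i)

variable {M : Type*} [AddCommGroup M] [Module k M] [Module S M] [Module T M]
  [IsScalarTower S T M] {ℳ : ℕ → Submodule k M}

include hST in
theorem IsGradedSMul.restrict (hM : IsGradedSMul 𝒯 ℳ) : IsGradedSMul 𝒮 ℳ := by
  intro i j s m hs hm
  rw [← algebraMap_smul T s m]
  exact hM (hST i s hs) hm

omit [Algebra k T] in
/-- Multiplication by an element of degree one lifts to a resolution. -/
theorem FreeRes.exists_mul_lift (hS : ConnectedGrading 𝒮) (PM : Projections ℳ)
    (hM : IsGradedSMul 𝒮 ℳ) (G : FreeRes 𝒮 ℳ) (u : T) (hu : ∀ j, ∀ m ∈ ℳ j, u • m ∈ ℳ (j + 1)) :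
    ∃ f : ∀ i, (G.ι i → S) →ₗ[S] (G.ι i → S),
      (∀ i b, f i (Pi.single b 1) ∈ basisPart 𝒮 (G.shift i) (G.shift i b + 1)) ∧
      (∀ i x, G.d i (f (i + 1) x) = f i (G.d i x)) ∧ ∀ x, G.ε (f 0 x) = u • G.ε x := by
  have hcom : SMulCommClass T S M := inferInstance
  obtain ⟨φ, hφ⟩ := exists_chainMap hS PM G.toGradedComplex.shiftOne G
    (u • G.ε) (fun j x hx => by
      refine basisPart_map_mem hM _ (fun b => ?_) hx
      exact hu _ _ (G.ε_mem _ _ (hS.single_mem _ b)))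
    (fun (x : G.ι 1 → S) => by
      change u • G.ε (G.d 0 x) = 0
      rw [G.exact_zero.apply_apply_eq_zero, smul_zero])
  exact ⟨φ.f, fun i b => φ.f_mem i _ _ (hS.single_mem (fun b => G.shift i b + 1) b), φ.comm, hφ⟩

/-- A resolution over `T = S[u]` built from a resolution over `S`. -/
theorem FreeRes.exists_extend (hS : ConnectedGrading 𝒮) (hT : ConnectedGrading 𝒯)
    (hu : θ X ∈ 𝒯 1) (PM : Projections ℳ) (hM : IsGradedSMul 𝒯 ℳ) (G : FreeRes 𝒮 ℳ) :
    ∃ (A B : GradedComplex 𝒯) (C : FreeRes 𝒯 ℳ) (Φ : A.Hom B)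
      (hΦ : ∀ x, (∃ y, B.d 0 y = Φ.f 0 x) → ∃ y, A.d 0 y = x),
      A = (G.toGradedComplex.extend θ hST hS hT).shiftOne ∧
      B = G.toGradedComplex.extend θ hST hS hT ∧ C.toGradedComplex = GradedComplex.cone Φ hΦ := by
  obtain ⟨f, hmem, hcomm, hfε⟩ := G.exists_mul_lift hS PM (hM.restrict hST) (θ X) fun j m hm => by
    rw [add_comm]; exact hM hu hm
  -- This lifts the presentation of `M` as the cokernel of `u ⊗ 1 - 1 ⊗ u` on `S[u] ⊗ M`, the source
  -- being shifted by one because `u` has degree one.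
  let Φ : (G.toGradedComplex.extend θ hST hS hT).shiftOne.Hom
      (G.toGradedComplex.extend θ hST hS hT) :=
    { f := fun i => θ X • LinearMap.id - freeExt T (f i)
      f_mem := fun i j (x : G.ι i → T) hx => by
        refine basisPart_map_mem (hT.gradedSMul_basisPart _) _ (fun b => ?_) hx
        refine Submodule.sub_mem _ ?_ ?_
        · change _ ∈ basisPart 𝒯 (G.shift i) (G.shift i b + 1)
          rw [add_comm]
          exact hT.gradedSMul_basisPart _ hu (hT.single_mem _ b)
        · rw [freeExt_single]
          exact freeIncl_mem hST (hmem i b)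
      comm := fun i (x : G.ι (i + 1) → T) => by
        change freeExt T (G.d i) (θ X • x - freeExt T (f (i + 1)) x) =
          θ X • freeExt T (G.d i) x - freeExt T (f i) (freeExt T (G.d i) x)
        rw [map_sub, map_smul, freeExt_comp, freeExt_comp]
        congr 3
        exact LinearMap.ext (hcomm i) }
  have hΦ : ∀ x, (∃ y, (G.toGradedComplex.extend θ hST hS hT).d 0 y = Φ.f 0 x) →
      ∃ y, (G.toGradedComplex.extend θ hST hS hT).d 0 y = x := by
    rintro x ⟨y, hy⟩
    exact freeExt_sub_injective θ (f 0) (G.d 0) (f 1) (hcomm 0) x y hy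
  let ε : (G.ι 0 → T) →ₗ[T] M := Fintype.linearCombination T fun b => G.ε (Pi.single b 1)
  have hε : ∀ x, ε (freeIncl S T _ x) = G.ε x := by
    intro x
    have : ε.restrictScalars S ∘ₗ freeIncl S T _ = G.ε :=
      (Pi.basisFun S _).ext fun b => by
        simp [freeIncl_single, ε, Fintype.linearCombination_apply_single]
    exact LinearMap.congr_fun this x
  have hd : ∀ x, ε (freeExt T (G.d 0) x) = 0 := by
    intro x
    have : ε ∘ₗ freeExt T (G.d 0) = 0 :=
      (Pi.basisFun T _).ext fun b => by
        simp [freeExt_single, hε, G.exact_zero.apply_apply_eq_zero]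
    exact LinearMap.congr_fun this x
  have hf : ∀ x, ε (Φ.f 0 x) = 0 := by
    intro x
    have : ε ∘ₗ Φ.f 0 = 0 :=
      (Pi.basisFun T _).ext fun b => by
        change ε (θ X • Pi.basisFun T (G.ι 0) b - freeExt T (f 0) (Pi.basisFun T (G.ι 0) b)) = 0
        rw [map_sub, map_smul, Pi.basisFun_apply, freeExt_single, hε, hfε, ← freeIncl_single (S := S),
          hε]
        exact sub_self _
    exact LinearMap.congr_fun this x
  refine ⟨_, _, FreeRes.ofCone Φ hΦ ε (fun j x hx => ?_) (fun m => ?_) hd hf (fun x hx => ?_),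
    Φ, hΦ, rfl, rfl, rfl⟩
  · refine basisPart_map_mem hM _ (fun b => ?_) hx
    rw [← freeIncl_single (S := S), hε]
    exact G.ε_mem _ _ (hS.single_mem _ b)
  · obtain ⟨x, rfl⟩ := G.ε_surjective m
    exact ⟨_, hε x⟩
  -- Modulo the image of `Φ`, the kernel of `ε` is represented by vectors over `S`, where exactness
  -- of `G` applies.
  · obtain ⟨y, z, rfl⟩ := exists_sub_add_incl θ (f 0) x
    have h1 := hf y
    change ε (θ X • y - freeExt T (f 0) y) = 0 at h1
    rw [map_add, h1, zero_add, hε] at hx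
    obtain ⟨w, rfl⟩ := (G.exact_zero z).1 hx
    refine ⟨freeIncl S T _ w, y, ?_⟩
    change freeExt T (G.d 0) (freeIncl S T _ w) + (θ X • y - freeExt T (f 0) y) = _
    rw [freeExt_freeIncl, add_comm]

end ScalarExtension

end GradedSyzygies

/-! ### Degree bounds read off from cones. -/

namespace GradedSyzygies

section ConeTor

variable {k : Type*} [Field k] {S : Type*} [CommRing S] [Algebra k S] [Nontrivial S]
  {𝒮 : ℕ → Submodule k S} (hS : ConnectedGrading 𝒮) {A B : GradedComplex 𝒮} (Φ : A.Hom B)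
  (hΦ : ∀ x, (∃ y, B.d 0 y = Φ.f 0 x) → ∃ y, A.d 0 y = x)

include hS

/-- A basis element of the source of a cone contributes to Tor if it is too large for the
target. -/
theorem GradedComplex.not_torVanishes_cone_source (hA : A.IsMinimal) {i : ℕ} (b : A.ι i)
    (hb : ∀ b', B.shift i b' < A.shift i b) :
    ¬ (GradedComplex.cone Φ hΦ).TorVanishes (i + 1) (A.shift i b) := by
  intro h
  obtain ⟨y, -, hy⟩ := h (Sum.elim (0 : B.ι (i + 1) → S) (Pi.single b 1))
    (mem_basisPart_sum.2 ⟨Submodule.zero_mem _, hS.single_mem _ b⟩) (by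
      have h1 : Φ.f i (Pi.single b 1) ∈ basisIrrelevant 𝒮 (B.ι i) :=
        mem_basisIrrelevant_of_lt hb (Φ.f_mem _ _ _ (hS.single_mem _ b))
      cases i with
      | zero =>
        change B.d 0 0 + Φ.f 0 (Pi.single b 1) ∈ _
        rw [map_zero, zero_add]
        exact h1
      | succ i =>
        refine mem_basisIrrelevant_sum.2 ⟨?_, ?_⟩
        · change B.d (i + 1) 0 + Φ.f (i + 1) (Pi.single b 1) ∈ _
          rw [map_zero, zero_add]
          exact h1
        · exact Submodule.neg_mem _ (hA _ _))
  have h2 := (mem_basisIrrelevant_sum.1 hy).2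
  change Pi.single b 1 - (-A.d i (y ∘ Sum.inr)) ∈ _ at h2
  rw [sub_neg_eq_add] at h2
  exact hS.single_notMem b ((Submodule.add_mem_iff_left _ (hA _ _)).1 h2)

/-- A basis element of the target of a cone contributes to Tor if it is too large for the
source. -/
theorem GradedComplex.not_torVanishes_cone_target (hB : B.IsMinimal) {i : ℕ} (b : B.ι i)
    (hb : ∀ b', A.shift i b' < B.shift i b) :
    ¬ (GradedComplex.cone Φ hΦ).TorVanishes i (B.shift i b) := by
  intro h
  have key : ∀ (y₁ : B.ι (i + 1) → S) (y₂ : A.ι i → S), y₂ ∈ A.part i (B.shift i b) →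
      (Pi.single b 1 - (B.d i y₁ + Φ.f i y₂)) ∉ basisIrrelevant 𝒮 (B.ι i) := by
    intro y₁ y₂ hy₂ hy
    refine hS.single_notMem b ?_
    rw [← sub_add_cancel (Pi.single b 1) (B.d i y₁ + Φ.f i y₂)]
    exact Submodule.add_mem _ hy (Submodule.add_mem _ (hB _ _)
      (map_mem_basisIrrelevant _ (mem_basisIrrelevant_of_lt hb hy₂)))
  cases i with
  | zero =>
    obtain ⟨y, hy1, hy⟩ := h (Pi.single b 1 : B.ι 0 → S) (hS.single_mem _ b) trivial
    exact key (y ∘ Sum.inl) (y ∘ Sum.inr) (mem_basisPart_sum.1 hy1).2 hy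
  | succ i =>
    obtain ⟨y, hy1, hy⟩ := h (Sum.elim (Pi.single b 1) (0 : A.ι i → S))
      (mem_basisPart_sum.2 ⟨hS.single_mem _ b, Submodule.zero_mem _⟩) (by
        cases i with
        | zero =>
          change B.d 0 (Pi.single b 1) + Φ.f 0 0 ∈ _
          rw [map_zero, add_zero]
          exact hB _ _
        | succ i =>
          refine mem_basisIrrelevant_sum.2 ⟨?_, ?_⟩
          · change B.d (i + 1) (Pi.single b 1) + Φ.f (i + 1) 0 ∈ _
            rw [map_zero, add_zero]
            exact hB _ _
          · change - A.d i 0 ∈ _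
            rw [map_zero, neg_zero]
            exact Submodule.zero_mem _)
    exact key (y ∘ Sum.inl) (y ∘ Sum.inr) (mem_basisPart_sum.1 hy1).2
      (mem_basisIrrelevant_sum.1 hy).1

end ConeTor

section ScalarExtension

open Polynomial

variable {k : Type*} [Field k] {S : Type*} [CommRing S] [Algebra k S] {𝒮 : ℕ → Submodule k S}
  {T : Type*} [CommRing T] [Algebra k T] {𝒯 : ℕ → Submodule k T} [Algebra S T]
  (θ : S[X] ≃ₐ[S] T) (hST : ∀ j, ∀ s ∈ 𝒮 j, algebraMap S T s ∈ 𝒯 j)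
  {M : Type*} [AddCommGroup M] [Module k M] [Module S M] [Module T M]
  [IsScalarTower S T M] {ℳ : ℕ → Submodule k M}
  (hS : ConnectedGrading 𝒮) (hT : ConnectedGrading 𝒯)
  (hu : θ X ∈ 𝒯 1) (PM : Projections ℳ) (hM : IsGradedSMul 𝒯 ℳ)

include θ hST hS hT hu PM hM

/-- Restricting scalars along `S → S[u]` costs one step of the linear range. -/
theorem FreeRes.shift_lt_of_torVanishes [Nontrivial T] {d p : ℕ} (F : FreeRes 𝒯 ℳ)
    (hF : ∀ i ≤ p + 1, ∀ j, d + i ≤ j → F.TorVanishes i j) (G : FreeRes 𝒮 ℳ) (hG : G.IsMinimal)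
    {i : ℕ} (hi : i ≤ p) (b : G.ι i) : G.shift i b < d + i := by
  obtain ⟨A, B, C, Φ, hΦ, rfl, rfl, hC⟩ := G.exists_extend θ hST hS hT hu PM hM
  by_contra! hb
  have : Nonempty (G.ι i) := ⟨b⟩
  -- With `b₀` of maximal shift, every generator of the target in homological degree `i` has degree
  -- below that of the shifted copy of `b₀`, so that copy cannot cancel.
  obtain ⟨b₀, hb₀⟩ := Finite.exists_max (G.shift i)
  have h1 := hF (i + 1) (by omega) (G.shift i b₀ + 1) (by have := hb₀ b; omega)
  have h2 := torVanishes_of_torVanishes hT PM C F h1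
  rw [hC] at h2
  refine GradedComplex.not_torVanishes_cone_source hT Φ hΦ (fun i v => ?_) b₀
    (fun b' => Nat.lt_succ_of_le (hb₀ b')) h2
  change freeExt T (G.d i) v ∈ _
  rw [freeExt, Fintype.linearCombination_apply]
  exact Submodule.sum_mem _ fun c _ => Submodule.smul_mem _ _
    (freeIncl_mem_basisIrrelevant hST (hG _ _))

/-- In degree `i + 1` the cone consists of `G_{i+1}` and `G_i(-1)`; the homological and internal
degrees of the second part rise together, so the bound survives adding a variable. -/
theorem FreeRes.exists_extend_shift_lt {d : ℕ} (G : FreeRes 𝒮 ℳ)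
    (hG : ∀ i b, G.shift i b < d + i) : ∃ C : FreeRes 𝒯 ℳ, ∀ i b, C.shift i b < d + i := by
  obtain ⟨A, B, C, Φ, hΦ, rfl, rfl, hC⟩ := G.exists_extend θ hST hS hT hu PM hM
  refine ⟨C, ?_⟩
  rw [hC]
  rintro (_ | i) b
  · exact hG 0 b
  · rcases b with b | b
    · exact hG (i + 1) b
    · exact Nat.succ_lt_succ (hG i b)

end ScalarExtension

section Truncation

variable {k : Type*} [Field k] {S : Type*} [CommRing S] [Algebra k S] [Nontrivial S]
  {𝒮 : ℕ → Submodule k S} (hS : ConnectedGrading 𝒮)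
  {N M Q : Type*} [AddCommGroup M] [Module k M] [Module S M] {ℳ : ℕ → Submodule k M}
  [AddCommGroup N] [Module k N] [Module S N] {𝒩 : ℕ → Submodule k N}
  [AddCommGroup Q] [Module k Q] [Module S Q] {𝒬 : ℕ → Submodule k Q}

include hS in
/-- Linearity of a resolution passes from a quotient `Q = M/N` to `M`. -/
theorem FreeRes.shift_lt_of_quotient (PM : Projections ℳ) (PQ : Projections 𝒬)
    (H : FreeRes 𝒮 𝒩) (L : FreeRes 𝒮 ℳ) (G : FreeRes 𝒮 𝒬)
    (f : N →ₗ[S] M) (hf : ∀ j, ∀ x ∈ 𝒩 j, f x ∈ ℳ j) (hfinj : Function.Injective f)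
    (g : M →ₗ[S] Q) (hg : ∀ j, ∀ x ∈ ℳ j, g x ∈ 𝒬 j) (hgsurj : Function.Surjective g)
    (hfg : Function.Exact f g) (hL : L.IsMinimal) {d p : ℕ} (hH : ∀ i b, H.shift i b < d + i)
    (hG : ∀ i ≤ p, ∀ j, d + i ≤ j → G.TorVanishes i j) {i : ℕ} (hi : i ≤ p) (b : L.ι i) :
    L.shift i b < d + i := by
  obtain ⟨Φ, hΦ⟩ := FreeRes.exists_chainMap hS PM H.toGradedComplex L (f ∘ₗ H.ε)
    (fun j x hx => hf _ _ (H.ε_mem j x hx))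
    (fun x => by simp [H.exact_zero.apply_apply_eq_zero])
  have hinj : ∀ x, (∃ y, L.d 0 y = Φ.f 0 x) → ∃ y, H.d 0 y = x := by
    rintro x ⟨y, hy⟩
    refine (H.exact_zero x).1 (hfinj ?_)
    have := hΦ x
    rw [← hy, L.exact_zero.apply_apply_eq_zero] at this
    rw [map_zero, this]
    rfl
  -- Injectivity of `f` makes the cone acyclic in positive degrees, and its zeroth homology is the
  -- cokernel of `f`, which is `Q`.
  let C : FreeRes 𝒮 𝒬 := FreeRes.ofCone Φ hinj (g ∘ₗ L.ε) (fun j x hx => hg _ _ (L.ε_mem j x hx))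
    (hgsurj.comp L.ε_surjective) (fun x => by simp [L.exact_zero.apply_apply_eq_zero])
    (fun x => by
      rw [LinearMap.comp_apply, hΦ]
      exact hfg.apply_apply_eq_zero _)
    (fun x hx => by
      obtain ⟨n, hn⟩ := (hfg _).1 hx
      obtain ⟨z, rfl⟩ := H.ε_surjective n
      obtain ⟨y, hy⟩ := (L.exact_zero (x - Φ.f 0 z)).1 (by
        rw [map_sub, hΦ, ← hn, LinearMap.comp_apply, sub_self])
      exact ⟨y, z, by rw [hy, sub_add_cancel]⟩)
  by_contra! hb
  exact GradedComplex.not_torVanishes_cone_target hS Φ hinj hL b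
    (fun b' => (hH i b').trans_le hb)
    (torVanishes_of_torVanishes hS PQ C G (hG i hi _ hb))

end Truncation

end GradedSyzygies

/-! ### Existence of minimal graded free resolutions. -/

namespace GradedSyzygies

section Sub

variable {k : Type*} [Field k] {S : Type*} [CommRing S] [Algebra k S]
  {M : Type*} [AddCommGroup M] [Module k M] [Module S M] [IsScalarTower k S M]

/-- The grading induced on a submodule. -/
def subGrading (ℳ : ℕ → Submodule k M) (K : Submodule S M) (j : ℕ) : Submodule k K :=
  (ℳ j).comap (K.subtype.restrictScalars k)

/-- The projections of a homogeneous submodule. -/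
def Projections.sub {ℳ : ℕ → Submodule k M} (P : Projections ℳ) (K : Submodule S M)
    (hK : ∀ x ∈ K, ∀ j, P.proj j x ∈ K) : Projections (subGrading ℳ K) where
  proj j :=
    { toFun := fun x => ⟨P.proj j x, hK x x.2 j⟩
      map_add' := fun x y => Subtype.ext (by simp)
      map_smul' := fun c x => Subtype.ext (by simp) }
  proj_mem j x := P.proj_mem j x
  proj_self hm := Subtype.ext (P.proj_self hm)
  proj_ne hm h := Subtype.ext (P.proj_ne hm h)
  exists_sum x := by
    obtain ⟨N, hN⟩ := P.exists_sum (x : M)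
    exact ⟨N, Subtype.ext (by rw [← hN]; simp [hN])⟩

theorem IsGradedSMul.sub {𝒮 : ℕ → Submodule k S} {ℳ : ℕ → Submodule k M}
    (h : IsGradedSMul 𝒮 ℳ) (K : Submodule S M) : IsGradedSMul 𝒮 (subGrading ℳ K) :=
  fun _ _ _ _ hs hm => h hs hm

end Sub

section Minimal

variable {k : Type*} [Field k] {S : Type*} [CommRing S] [Algebra k S]
  {𝒮 : ℕ → Submodule k S}
  {M : Type*} [AddCommGroup M] [Module k M] [Module S M] {ℳ : ℕ → Submodule k M}

theorem ConnectedGrading.mem_irrelevantIdeal_of_proj_zero (hS : ConnectedGrading 𝒮) {s : S}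
    (hs : hS.proj 0 s = 0) : s ∈ irrelevantIdeal 𝒮 := by
  obtain ⟨N, hN⟩ := hS.exists_sum s
  rw [← hN]
  refine Submodule.sum_mem _ fun j _ => ?_
  rcases Nat.eq_zero_or_pos j with rfl | hj
  · rw [hs]; exact Submodule.zero_mem _
  · exact Ideal.subset_span ⟨j, hj, hS.proj_mem j s⟩

omit [Algebra k S] in
theorem exists_homogeneous_generators (PM : Projections ℳ) [Module.Finite S M] :
    ∃ (r : ℕ) (a : Fin r → ℕ) (g : Fin r → M), (∀ b, g b ∈ ℳ (a b)) ∧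
      Submodule.span S (Set.range g) = ⊤ := by
  classical
  obtain ⟨s, hs⟩ := Module.finite_def.1 (inferInstance : Module.Finite S M)
  choose N hN using PM.exists_sum
  let t : Finset M := s.biUnion fun m => (Finset.range (N m)).image fun j => PM.proj j m
  have ht : ∀ x ∈ t, ∃ j, x ∈ ℳ j := by
    intro x hx
    simp only [t, Finset.mem_biUnion, Finset.mem_image] at hx
    obtain ⟨m, -, j, -, rfl⟩ := hx
    exact ⟨j, PM.proj_mem j m⟩
  refine ⟨t.card, fun b => (ht _ (t.equivFin.symm b).2).choose, fun b => t.equivFin.symm b,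
    fun b => (ht _ (t.equivFin.symm b).2).choose_spec, ?_⟩
  have hrange : Set.range (fun b => ((t.equivFin.symm b : t) : M)) = t := by
    ext x
    constructor
    · rintro ⟨b, rfl⟩; exact (t.equivFin.symm b).2
    · intro hx; exact ⟨t.equivFin ⟨x, hx⟩, by simp⟩
  rw [hrange, eq_top_iff, ← hs, Submodule.span_le]
  intro m hm
  rw [← hN m]
  refine Submodule.sum_mem _ fun j hj => Submodule.subset_span ?_
  simp only [t, Finset.coe_biUnion, Set.mem_iUnion, Finset.coe_image]
  exact ⟨m, hm, j, hj, rfl⟩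

/-- A finitely generated graded module over a connected graded algebra has a minimal cover by a
graded free module. -/
theorem ConnectedGrading.exists_minimal_cover (hS : ConnectedGrading 𝒮) [IsScalarTower k S M]
    (PM : Projections ℳ)
    (hM : IsGradedSMul 𝒮 ℳ) [Module.Finite S M] :
    ∃ (r : ℕ) (a : Fin r → ℕ) (ε : (Fin r → S) →ₗ[S] M),
      (∀ j, ∀ x ∈ basisPart 𝒮 a j, ε x ∈ ℳ j) ∧ Function.Surjective ε ∧
      ∀ x, ε x = 0 → x ∈ basisIrrelevant 𝒮 (Fin r) := by
  classical
  have hex := exists_homogeneous_generators (S := S) PM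
  -- The cover uses the least possible number of homogeneous generators.
  obtain ⟨a, g, hg, hspan⟩ := Nat.find_spec hex
  have hmin : ∀ m, m < Nat.find hex → _ := fun m hm => Nat.find_min hex hm
  generalize Nat.find hex = r at *
  refine ⟨r, a, Fintype.linearCombination S g, fun j x hx => linearCombination_mem hM hg hx, ?_, ?_⟩
  · rw [← LinearMap.range_eq_top, Fintype.range_linearCombination, hspan]
  · intro x hx
    by_contra hxi
    rw [mem_basisIrrelevant, not_forall] at hxi
    obtain ⟨b, hb⟩ := hxi
    have hb0 : hS.proj 0 (x b) ≠ 0 := fun h => hb (hS.mem_irrelevantIdeal_of_proj_zero h)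
    obtain ⟨c, hc⟩ := hS.exists_algebraMap (hS.proj_mem 0 (x b))
    have hc0 : c ≠ 0 := by rintro rfl; rw [map_zero] at hc; exact hb0 hc.symm
    -- In degree `a b` the coefficient of `g b` becomes the nonzero scalar `c`. The relation then
    -- expresses `g b` through the other generators, against the choice of `r`.
    set w := (hS.freeProj a).proj (a b) x with hw
    have hwb : w b = algebraMap k S c := by
      rw [hc, hw]; simp [freeProj]
    have hw0 : Fintype.linearCombination S g w = 0 := by
      have := (hS.freeProj a).map_proj PM (Fintype.linearCombination S g).toAddMonoidHom
        (fun j x hx => linearCombination_mem hM hg hx) (a b) x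
      simp only [LinearMap.toAddMonoidHom_coe] at this
      rw [hw, this, hx, map_zero]
    obtain _ | r := r
    · exact b.elim0
    refine hmin r (Nat.lt_succ_self r) ⟨a ∘ b.succAbove, g ∘ b.succAbove, fun _ => hg _, ?_⟩
    rw [eq_top_iff, ← hspan, Submodule.span_le]
    have hother : ∀ c, g (b.succAbove c) ∈ Submodule.span S (Set.range (g ∘ b.succAbove)) :=
      fun c => Submodule.subset_span ⟨c, rfl⟩
    rintro _ ⟨b', rfl⟩
    rcases eq_or_ne b' b with rfl | hne
    · rw [Fintype.linearCombination_apply, Fin.sum_univ_succAbove _ b', hwb,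
        algebraMap_smul] at hw0
      have h1 : g b' = -(algebraMap k S c⁻¹ • ∑ i, w (b'.succAbove i) • g (b'.succAbove i)) := by
        rw [← eq_neg_iff_add_eq_zero] at hw0
        rw [algebraMap_smul, ← smul_neg, ← hw0, smul_smul, inv_mul_cancel₀ hc0, one_smul]
      rw [SetLike.mem_coe, h1]
      exact Submodule.neg_mem _ (Submodule.smul_mem _ _ (Submodule.sum_mem _ fun c _ =>
        Submodule.smul_mem _ _ (hother c)))
    · obtain ⟨c, rfl⟩ := Fin.exists_succAbove_eq hne
      exact hother c

/-- A homogeneous submodule of a graded free module. -/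
structure FreeSub (hS : ConnectedGrading 𝒮) where
  r : ℕ
  a : Fin r → ℕ
  K : Submodule S (Fin r → S)
  hK : ∀ x ∈ K, ∀ j, (hS.freeProj a).proj j x ∈ K

/-- The kernel of a homogeneous map. -/
def FreeSub.ker (hS : ConnectedGrading 𝒮) (PM : Projections ℳ) {r : ℕ} (a : Fin r → ℕ)
    (f : (Fin r → S) →ₗ[S] M) (hf : ∀ j, ∀ x ∈ basisPart 𝒮 a j, f x ∈ ℳ j) : FreeSub hS where
  r := r
  a := a
  K := LinearMap.ker f
  hK x hx j := by
    have := (hS.freeProj a).map_proj PM f.toAddMonoidHom hf j x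
    simp only [LinearMap.toAddMonoidHom_coe] at this
    rw [LinearMap.mem_ker] at hx ⊢
    rw [this, hx, map_zero]

/-- A submodule of a finite free module over a Noetherian ring is finitely generated, so it has a
minimal cover. The kernel of that cover is again a homogeneous submodule of a free module, which
lets the construction repeat. -/
theorem FreeSub.exists_next {hS : ConnectedGrading 𝒮} [IsNoetherianRing S] (X : FreeSub hS) :
    ∃ (Y : FreeSub hS) (f : (Fin Y.r → S) →ₗ[S] (Fin X.r → S)),
      (∀ j, ∀ x ∈ basisPart 𝒮 Y.a j, f x ∈ basisPart 𝒮 X.a j) ∧ LinearMap.range f = X.K ∧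
      LinearMap.ker f = Y.K ∧ Y.K ≤ basisIrrelevant 𝒮 (Fin Y.r) := by
  obtain ⟨r, a, ε, hε, hsurj, hmin⟩ := hS.exists_minimal_cover
    ((hS.freeProj X.a).sub X.K X.hK) ((hS.gradedSMul_basisPart X.a).sub X.K)
  have hrange : LinearMap.range (X.K.subtype ∘ₗ ε) = X.K := by
    rw [LinearMap.range_comp, LinearMap.range_eq_top.2 hsurj, Submodule.map_top,
      Submodule.range_subtype]
  exact ⟨FreeSub.ker hS (hS.freeProj X.a) a (X.K.subtype ∘ₗ ε) hε, X.K.subtype ∘ₗ ε, hε, hrange,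
    rfl, fun x hx => hmin x (Subtype.ext hx)⟩

variable [IsNoetherianRing S] (hS : ConnectedGrading 𝒮) (PM : Projections ℳ) {r : ℕ}
  (a : Fin r → ℕ) (ε : (Fin r → S) →ₗ[S] M) (hε : ∀ j, ∀ x ∈ basisPart 𝒮 a j, ε x ∈ ℳ j)
  (hsurj : Function.Surjective ε)

/-- Successive minimal syzygies. -/
def syzygySeq : ℕ → FreeSub hS
  | 0 => FreeSub.ker hS PM a ε hε
  | i + 1 => (syzygySeq i).exists_next.choose

/-- The maps between successive minimal covers of syzygies. -/
def syzygyMap (i : ℕ) : (Fin (syzygySeq hS PM a ε hε (i + 1)).r → S) →ₗ[S]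
    (Fin (syzygySeq hS PM a ε hε i).r → S) :=
  (syzygySeq hS PM a ε hε i).exists_next.choose_spec.choose

theorem syzygyMap_mem (i j : ℕ) (x : Fin (syzygySeq hS PM a ε hε (i + 1)).r → S)
    (hx : x ∈ basisPart 𝒮 (syzygySeq hS PM a ε hε (i + 1)).a j) :
    syzygyMap hS PM a ε hε i x ∈ basisPart 𝒮 (syzygySeq hS PM a ε hε i).a j :=
  (syzygySeq hS PM a ε hε i).exists_next.choose_spec.choose_spec.1 j x hx

theorem range_syzygyMap (i : ℕ) :
    LinearMap.range (syzygyMap hS PM a ε hε i) = (syzygySeq hS PM a ε hε i).K :=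
  (syzygySeq hS PM a ε hε i).exists_next.choose_spec.choose_spec.2.1

theorem ker_syzygyMap (i : ℕ) :
    LinearMap.ker (syzygyMap hS PM a ε hε i) = (syzygySeq hS PM a ε hε (i + 1)).K :=
  (syzygySeq hS PM a ε hε i).exists_next.choose_spec.choose_spec.2.2.1

theorem syzygySeq_le (i : ℕ) : (syzygySeq hS PM a ε hε (i + 1)).K ≤
    basisIrrelevant 𝒮 (Fin (syzygySeq hS PM a ε hε (i + 1)).r) :=
  (syzygySeq hS PM a ε hε i).exists_next.choose_spec.choose_spec.2.2.2

/-- A graded free resolution starting with a given cover, minimal from there on. -/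
def minimalResolution : GradedFreeResolution 𝒮 ℳ where
  rank i := (syzygySeq hS PM a ε hε i).r
  shift i := (syzygySeq hS PM a ε hε i).a
  d := syzygyMap hS PM a ε hε
  ε := ε
  d_homogeneous := syzygyMap_mem hS PM a ε hε
  ε_homogeneous := hε
  ε_surjective := hsurj
  exact_zero := LinearMap.exact_iff.2 (range_syzygyMap hS PM a ε hε 0).symm
  exact_succ i := LinearMap.exact_iff.2 <|
    (ker_syzygyMap hS PM a ε hε i).trans (range_syzygyMap hS PM a ε hε (i + 1)).symm

/-- The image of each differential is the kernel of the preceding cover. Every cover after the first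
is minimal by construction, so only `ε` needs a hypothesis; this permits starting from an explicit
cover. -/
theorem minimalResolution_isMinimal (hker : ∀ x, ε x = 0 → x ∈ basisIrrelevant 𝒮 (Fin r)) :
    (minimalResolution hS PM a ε hε hsurj).toFreeRes.IsMinimal := by
  intro i (v : Fin (syzygySeq hS PM a ε hε (i + 1)).r → S)
  have h1 : syzygyMap hS PM a ε hε i v ∈ (syzygySeq hS PM a ε hε i).K := by
    rw [← range_syzygyMap]
    exact LinearMap.mem_range_self _ v
  cases i with
  | zero => exact hker _ h1
  | succ i => exact syzygySeq_le hS PM a ε hε i h1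

include hS PM in
theorem exists_minimal_freeRes [IsScalarTower k S M] (hM : IsGradedSMul 𝒮 ℳ) [Module.Finite S M] :
    ∃ L : FreeRes 𝒮 ℳ, L.IsMinimal := by
  obtain ⟨r, a, ε, hε, hsurj, hmin⟩ := hS.exists_minimal_cover PM hM
  exact ⟨_, minimalResolution_isMinimal hS PM a ε hε hsurj hmin⟩

end Minimal

end GradedSyzygies

/-! ### The gradings of `R`, `Sym(W)` and `R/J`, and `Sym(W + ku)` as a polynomial ring over
`Sym(W)`. -/

namespace GradedSyzygies

open MvPolynomial

section Coordinates

variable (k : Type u) [Field k] (n : ℕ)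

/-- The connected grading of the homogeneous coordinate ring. -/
def coordConnected : ConnectedGrading (coordGrading k n) where
  proj j := homogeneousComponent j
  proj_mem j m := homogeneousComponent_mem j m
  proj_self hm := by rw [homogeneousComponent_of_mem hm, if_pos rfl]
  proj_ne hm h := by rw [homogeneousComponent_of_mem hm, if_neg h.symm]
  exists_sum m := ⟨_, sum_homogeneousComponent m⟩
  mul_mem hs ht := IsHomogeneous.mul hs ht
  algebraMap_mem c := isHomogeneous_C _ c
  exists_algebraMap {s} hs := ⟨coeff 0 s, by
    have := homogeneousComponent_zero s
    rw [homogeneousComponent_of_mem hs, if_pos rfl] at this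
    exact this.symm⟩

end Coordinates

variable {k : Type u} [Field k] {n : ℕ}

/-- `Sym(W)` is spanned by products of elements of `W`, which are homogeneous. -/
theorem homogeneousComponent_mem_symAlg {W : Submodule k (MvPolynomial (Fin (n + 1)) k)}
    (hW : W ≤ coordGrading k n 1) {x : MvPolynomial (Fin (n + 1)) k} (hx : x ∈ symAlg W) (j : ℕ) :
    homogeneousComponent j x ∈ symAlg W := by
  have h1 : ∀ y ∈ Submonoid.closure (W : Set (MvPolynomial (Fin (n + 1)) k)),
      y ∈ symAlg W ∧ ∃ i, y ∈ coordGrading k n i := by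
    intro y hy
    induction hy using Submonoid.closure_induction with
    | mem y hy => exact ⟨Algebra.subset_adjoin hy, 1, hW hy⟩
    | one => exact ⟨one_mem _, 0, (coordConnected k n).one_mem⟩
    | mul y z _ _ hy hz =>
      obtain ⟨hy, i, hi⟩ := hy
      obtain ⟨hz, i', hi'⟩ := hz
      exact ⟨mul_mem hy hz, i + i', (coordConnected k n).mul_mem hi hi'⟩
  rw [← Subalgebra.mem_toSubmodule, Algebra.adjoin_eq_span] at hx
  induction hx using Submodule.span_induction with
  | mem y hy =>
    obtain ⟨hy, i, hi⟩ := h1 y hy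
    rw [homogeneousComponent_of_mem hi]
    split_ifs
    · exact hy
    · exact zero_mem _
  | zero => rw [map_zero]; exact zero_mem _
  | add y z _ _ hy hz => rw [map_add]; exact add_mem hy hz
  | smul c y _ hy => rw [map_smul]; exact Subalgebra.smul_mem _ hy c

/-- The connected grading of `Sym(W)`. -/
def symConnected {W : Submodule k (MvPolynomial (Fin (n + 1)) k)}
    (hW : W ≤ coordGrading k n 1) : ConnectedGrading (symGrading W) where
  proj j :=
    { toFun := fun x => ⟨homogeneousComponent j (x : MvPolynomial (Fin (n + 1)) k),
        homogeneousComponent_mem_symAlg hW x.2 j⟩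
      map_add' := fun x y => Subtype.ext (by simp)
      map_smul' := fun c x => Subtype.ext (by simp) }
  proj_mem j x := homogeneousComponent_mem j (x : MvPolynomial (Fin (n + 1)) k)
  proj_self hm := Subtype.ext ((coordConnected k n).proj_self hm)
  proj_ne hm h := Subtype.ext ((coordConnected k n).proj_ne hm h)
  exists_sum x := by
    obtain ⟨N, hN⟩ := (coordConnected k n).exists_sum (x : MvPolynomial (Fin (n + 1)) k)
    refine ⟨N, Subtype.ext ?_⟩
    rw [AddSubmonoidClass.coe_finsetSum]
    exact hN
  mul_mem hs ht := IsHomogeneous.mul hs ht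
  algebraMap_mem c := isHomogeneous_C _ c
  exists_algebraMap hs := by
    obtain ⟨c, hc⟩ := (coordConnected k n).exists_algebraMap hs
    exact ⟨c, Subtype.ext hc⟩

/-- Ideals containing the homogeneous components of their elements. -/
def IsHomog (J : Ideal (MvPolynomial (Fin (n + 1)) k)) : Prop :=
  ∀ x ∈ J, ∀ j, homogeneousComponent j x ∈ J

/-- The projections of `R/J`. -/
def quotProj {J : Ideal (MvPolynomial (Fin (n + 1)) k)} (hJ : IsHomog J) :
    Projections (quotGrading J) where
  proj j := (Submodule.Quotient.restrictScalarsEquiv k J).toLinearMap ∘ₗ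
    Submodule.mapQ (J.restrictScalars k) (J.restrictScalars k) (homogeneousComponent j)
      (fun x hx => hJ x hx j) ∘ₗ (Submodule.Quotient.restrictScalarsEquiv k J).symm.toLinearMap
  proj_mem j m := by
    obtain ⟨x, rfl⟩ := Ideal.Quotient.mk_surjective m
    exact ⟨homogeneousComponent j x, homogeneousComponent_mem j x, rfl⟩
  proj_self {j m} hm := by
    obtain ⟨x, hx, rfl⟩ := hm
    exact congrArg (Ideal.Quotient.mk J) ((coordConnected k n).proj_self hx)
  proj_ne {i j m} hm h := by
    obtain ⟨x, hx, rfl⟩ := hm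
    exact (congrArg (Ideal.Quotient.mk J) ((coordConnected k n).proj_ne hx h)).trans (map_zero _)
  exists_sum m := by
    obtain ⟨x, rfl⟩ := Ideal.Quotient.mk_surjective m
    obtain ⟨N, hN⟩ := (coordConnected k n).exists_sum x
    refine ⟨N, ?_⟩
    conv_rhs => rw [← hN]
    rw [map_sum]
    rfl

theorem mk_mem_quotGrading {J : Ideal (MvPolynomial (Fin (n + 1)) k)} {j : ℕ}
    {x : MvPolynomial (Fin (n + 1)) k} (hx : x ∈ coordGrading k n j) :
    Ideal.Quotient.mk J x ∈ quotGrading J j := ⟨x, hx, rfl⟩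

theorem gradedSMul_quotGrading (J : Ideal (MvPolynomial (Fin (n + 1)) k)) :
    IsGradedSMul (coordGrading k n) (quotGrading J) := by
  rintro i j s _ hs ⟨x, hx, rfl⟩
  exact ⟨s * x, IsHomogeneous.mul hs hx, rfl⟩

theorem IsGradedSMul.symAlg {M : Type*} [AddCommGroup M] [Module k M]
    [Module (MvPolynomial (Fin (n + 1)) k) M] {ℳ : ℕ → Submodule k M}
    (h : IsGradedSMul (coordGrading k n) ℳ) (W : Submodule k (MvPolynomial (Fin (n + 1)) k)) :
    IsGradedSMul (symGrading W) ℳ :=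
  fun _ _ s _ hs hm => h (s := (s : MvPolynomial (Fin (n + 1)) k)) hs hm

section Transcendental

open Polynomial in
/-- A linear form outside `W` is transcendental over `Sym(W)`. -/
theorem eval₂_symAlg_injective {W : Submodule k (MvPolynomial (Fin (n + 1)) k)}
    (hW : W ≤ coordGrading k n 1) {u : MvPolynomial (Fin (n + 1)) k} (hu : u ∈ coordGrading k n 1)
    (huW : u ∉ W) (p : (symAlg W)[X])
    (hp : p.eval₂ (symAlg W).val.toRingHom u = 0) : p = 0 := by
  obtain ⟨f, hfu, hfW⟩ := Submodule.exists_le_ker_of_notMem huW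
  -- For a functional `f` vanishing on `W` but not at `u`, the substitution `v ↦ v + (f v / f u) X`
  -- fixes `Sym(W)` and sends `u` to `u + X`. Applied to `p(u) = 0` it gives `p(u + X) = 0`, so the
  -- Taylor shift of `p` vanishes.
  let ψ : MvPolynomial (Fin (n + 1)) k →ₐ[k] (MvPolynomial (Fin (n + 1)) k)[X] :=
    MvPolynomial.aeval fun i => Polynomial.C (MvPolynomial.X i) +
      Polynomial.C (MvPolynomial.C (f (MvPolynomial.X i) / f u)) * Polynomial.X
  have hψ : ∀ v ∈ coordGrading k n 1,
      ψ v = Polynomial.C v + Polynomial.C (MvPolynomial.C (f v / f u)) * Polynomial.X := by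
    intro v hv
    rw [show coordGrading k n 1 = _ from homogeneousSubmodule_one_eq_span_X] at hv
    induction hv using Submodule.span_induction with
    | mem y hy =>
      obtain ⟨i, rfl⟩ := hy
      simp [ψ]
    | zero => simp
    | add y z _ _ hy hz =>
      rw [map_add, hy, hz, map_add, map_add, add_div, map_add, map_add]
      ring
    | smul c y _ hy =>
      have hfc : f (c • y) = c * f y := by rw [map_smul, smul_eq_mul]
      have hC : algebraMap k (MvPolynomial (Fin (n + 1)) k)[X] c =
        Polynomial.C (MvPolynomial.C c) := rfl
      rw [map_smul, hy, hfc, mul_div_assoc, Algebra.smul_def, hC, MvPolynomial.smul_eq_C_mul,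
        MvPolynomial.C_mul, Polynomial.C_mul, Polynomial.C_mul]
      ring
  have h1 : ψ.comp (symAlg W).val =
      (IsScalarTower.toAlgHom k (MvPolynomial (Fin (n + 1)) k)
        (MvPolynomial (Fin (n + 1)) k)[X]).comp (symAlg W).val := by
    refine AlgHom.adjoin_ext fun w hw => ?_
    have hfw : f w = 0 := hfW hw
    simp [hψ w (hW hw), hfw]
  have h2 : ψ u = Polynomial.X + Polynomial.C u := by
    rw [hψ u hu, div_self hfu]
    simp [add_comm]
  have h3 : taylor u (p.map (symAlg W).val.toRingHom) = 0 := by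
    rw [taylor_apply, Polynomial.comp, Polynomial.eval₂_map]
    have := congrArg ψ hp
    rw [map_zero] at this
    rw [← this]
    change _ = ψ.toRingHom _
    rw [Polynomial.hom_eval₂]
    congr 1
    · exact RingHom.ext fun s => AlgHom.congr_fun h1.symm s
    · exact h2.symm
  have h4 := taylor_injective u (h3.trans (map_zero _).symm)
  exact (Polynomial.map_injective _ Subtype.val_injective) (h4.trans (Polynomial.map_zero _).symm)

open Polynomial in
/-- `Sym(W + ku)` is a polynomial ring over `Sym(W)`. -/
theorem exists_polynomial_equiv {W : Submodule k (MvPolynomial (Fin (n + 1)) k)}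
    (hW : W ≤ coordGrading k n 1) {u : MvPolynomial (Fin (n + 1)) k} (hu : u ∈ coordGrading k n 1)
    (huW : u ∉ W) {T : Type*} [CommRing T] [Algebra (symAlg W) T]
    (f : T →+* MvPolynomial (Fin (n + 1)) k) (hf : Function.Injective f)
    (hfW : ∀ s : symAlg W, f (algebraMap (symAlg W) T s) = s) (t : T) (ht : f t = u)
    (hT : ∀ x, f x ∈ symAlg (W ⊔ k ∙ u)) :
    ∃ θ : (symAlg W)[X] ≃ₐ[symAlg W] T, θ Polynomial.X = t := by
  have key : ∀ p : (symAlg W)[X], f (Polynomial.aeval t p) =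
      p.eval₂ (symAlg W).val.toRingHom u := by
    intro p
    rw [Polynomial.aeval_def, Polynomial.hom_eval₂, ht]
    congr 1
    exact RingHom.ext hfW
  refine ⟨AlgEquiv.ofBijective (Polynomial.aeval t) ⟨?_, ?_⟩, Polynomial.aeval_X t⟩
  · rw [injective_iff_map_eq_zero]
    intro p hp
    refine eval₂_symAlg_injective hW hu huW p ?_
    rw [← key, hp, map_zero]
  · intro x
    have h1 : symAlg (W ⊔ k ∙ u) ≤
        ((Polynomial.aeval (R := symAlg W) u).range).restrictScalars k := by
      refine Algebra.adjoin_le ?_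
      have : W ⊔ k ∙ u ≤ Subalgebra.toSubmodule
          (((Polynomial.aeval (R := symAlg W) u).range).restrictScalars k) := by
        refine sup_le (fun w hw => ?_) ?_
        · exact ⟨Polynomial.C ⟨w, Algebra.subset_adjoin hw⟩, by
            rw [AlgHom.toRingHom_eq_coe, RingHom.coe_coe, Polynomial.aeval_C]; rfl⟩
        · rw [Submodule.span_singleton_le_iff_mem]
          exact ⟨Polynomial.X, by simp⟩
      exact this
    obtain ⟨p, hp⟩ := h1 (hT x)
    refine ⟨p, hf ?_⟩
    rw [key]
    exact hp

end Transcendental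

end GradedSyzygies

/-! ### Removing or adding variables one at a time. -/

namespace GradedSyzygies

open MvPolynomial

variable {k : Type u} [Field k] {n : ℕ}

instance finite_coordGrading (k : Type u) [Field k] (n j : ℕ) :
    Module.Finite k (coordGrading k n j) := by
  rw [Module.Finite.iff_fg, coordGrading, ← homogeneousSubmodule_one_pow,
    homogeneousSubmodule_one_eq_span_X]
  exact Submodule.FG.pow (Submodule.fg_span (Set.finite_range _)) j

theorem finite_of_le_coordGrading {W : Submodule k (MvPolynomial (Fin (n + 1)) k)} {j : ℕ}
    (hW : W ≤ coordGrading k n j) : Module.Finite k W :=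
  Submodule.finiteDimensional_of_le hW

theorem isNoetherianRing_symAlg {W : Submodule k (MvPolynomial (Fin (n + 1)) k)}
    (hW : W ≤ coordGrading k n 1) : IsNoetherianRing (symAlg W) := by
  obtain ⟨s, hs⟩ := Module.Finite.iff_fg.1 (finite_of_le_coordGrading hW)
  have : symAlg W = Algebra.adjoin k (s : Set (MvPolynomial (Fin (n + 1)) k)) := by
    rw [symAlg, ← hs, Algebra.adjoin_span]
  rw [this]
  exact isNoetherianRing_of_fg (Subalgebra.fg_adjoin_finset s)

theorem finrank_sup_span {W : Submodule k (MvPolynomial (Fin (n + 1)) k)}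
    (hW : W ≤ coordGrading k n 1) {u : MvPolynomial (Fin (n + 1)) k} (hu : u ∉ W) :
    Module.finrank k ↥(W ⊔ k ∙ u) = Module.finrank k W + 1 := by
  have := finite_of_le_coordGrading hW
  have h1 := Submodule.finrank_sup_add_finrank_inf_eq W (k ∙ u)
  have hu0 : u ≠ 0 := by rintro rfl; exact hu W.zero_mem
  have h2 : W ⊓ k ∙ u = ⊥ := (Submodule.disjoint_span_singleton' hu0).2 hu |>.eq_bot
  rw [h2, finrank_bot, add_zero, finrank_span_singleton hu0] at h1
  exact h1

theorem inclusion_isScalarTower {A : Type*} [CommRing A] [Algebra k A] {S S' : Subalgebra k A}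
    (h : S ≤ S') {M : Type*} [AddCommGroup M] [Module A M] :
    letI := (Subalgebra.inclusion h).toAlgebra
    IsScalarTower S S' M :=
  letI := (Subalgebra.inclusion h).toAlgebra
  ⟨fun s t m => mul_smul (s : A) (t : A) m⟩

section Inclusion

variable {W W' : Submodule k (MvPolynomial (Fin (n + 1)) k)} (h : W ≤ W')

/-- `Sym(W')` as an algebra over `Sym(W)`. -/
@[reducible] def symAlgebra : Algebra (symAlg W) (symAlg W') :=
  (Subalgebra.inclusion (Algebra.adjoin_mono h)).toAlgebra

theorem symAlgebra_scalarTower {M : Type*} [AddCommGroup M]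
    [Module (MvPolynomial (Fin (n + 1)) k) M] :
    let _ := symAlgebra h
    IsScalarTower (symAlg W) (symAlg W') M :=
  inclusion_isScalarTower (Algebra.adjoin_mono h)

include h in
theorem finite_symAlg_of_le {M : Type*} [AddCommGroup M]
    [Module (MvPolynomial (Fin (n + 1)) k) M] [Module.Finite (symAlg W) M] :
    Module.Finite (symAlg W') M :=
  let _ := symAlgebra h
  have := symAlgebra_scalarTower h (M := M)
  Module.Finite.of_restrictScalars_finite (symAlg W) (symAlg W') M

theorem exists_symAlg_polynomial_equiv (hW : W ≤ coordGrading k n 1)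
    {u : MvPolynomial (Fin (n + 1)) k} (hu : u ∈ coordGrading k n 1) (huW : u ∉ W) :
    let _ := symAlgebra (le_sup_left : W ≤ W ⊔ k ∙ u)
    ∃ θ : Polynomial (symAlg W) ≃ₐ[symAlg W] symAlg (W ⊔ k ∙ u),
      θ Polynomial.X ∈ symGrading (W ⊔ k ∙ u) 1 := by
  let _ := symAlgebra (le_sup_left : W ≤ W ⊔ k ∙ u)
  obtain ⟨θ, hθ⟩ := exists_polynomial_equiv hW hu huW (T := symAlg (W ⊔ k ∙ u))
    (symAlg (W ⊔ k ∙ u)).val.toRingHom Subtype.val_injective (fun s => rfl)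
    ⟨u, Algebra.subset_adjoin (Submodule.mem_sup_right (Submodule.mem_span_singleton_self u))⟩ rfl
    (fun x => x.2)
  refine ⟨θ, ?_⟩
  rw [hθ]
  exact hu

end Inclusion

section Chain

variable {M : Type*} [AddCommGroup M] [Module k M] [Module (MvPolynomial (Fin (n + 1)) k) M]
  [IsScalarTower k (MvPolynomial (Fin (n + 1)) k) M] {ℳ : ℕ → Submodule k M}
  (PM : Projections ℳ) (hM : IsGradedSMul (coordGrading k n) ℳ)
  {W : Submodule k (MvPolynomial (Fin (n + 1)) k)} (hW : W ≤ coordGrading k n 1)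

include PM hM hW

/-- The descent `W + ku → W`: the minimal resolution over `Sym(W)` satisfies the bound, one
homological step shorter. -/
theorem exists_torVanishes_of_sup [Module.Finite (symAlg W) M]
    {u : MvPolynomial (Fin (n + 1)) k} (hu : u ∈ coordGrading k n 1) (huW : u ∉ W) {d p : ℕ}
    (F : FreeRes (symGrading (W ⊔ k ∙ u)) ℳ)
    (hF : ∀ i ≤ p + 1, ∀ j, d + i ≤ j → F.TorVanishes i j) :
    ∃ G : FreeRes (symGrading W) ℳ, ∀ i ≤ p, ∀ b, G.shift i b < d + i := by
  let _ := symAlgebra (le_sup_left : W ≤ W ⊔ k ∙ u)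
  have := symAlgebra_scalarTower (le_sup_left : W ≤ W ⊔ k ∙ u) (M := M)
  have := isNoetherianRing_symAlg hW
  obtain ⟨θ, hθ⟩ := exists_symAlg_polynomial_equiv hW hu huW
  have hW' : W ⊔ k ∙ u ≤ coordGrading k n 1 :=
    sup_le hW ((Submodule.span_singleton_le_iff_mem _ _).2 hu)
  obtain ⟨G, hG⟩ := exists_minimal_freeRes (symConnected hW) PM (hM.symAlg W)
  exact ⟨G, fun i hi b => FreeRes.shift_lt_of_torVanishes θ (fun j s hs => hs) (symConnected hW)
    (symConnected hW') hθ PM (hM.symAlg _) F hF G hG hi b⟩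

/-- The first descent, where the larger ring is `R` itself instead of its subalgebra generated by
all linear forms, because the given resolution is over `R`. -/
theorem exists_torVanishes_of_sup_eq [Module.Finite (symAlg W) M]
    {u : MvPolynomial (Fin (n + 1)) k} (hu : u ∈ coordGrading k n 1) (huW : u ∉ W)
    (hWu : W ⊔ k ∙ u = coordGrading k n 1) {d p : ℕ}
    (F : FreeRes (coordGrading k n) ℳ)
    (hF : ∀ i ≤ p + 1, ∀ j, d + i ≤ j → F.TorVanishes i j) :
    ∃ G : FreeRes (symGrading W) ℳ, ∀ i ≤ p, ∀ b, G.shift i b < d + i := by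
  have := isNoetherianRing_symAlg hW
  obtain ⟨θ, hθ⟩ := exists_polynomial_equiv hW hu huW (T := MvPolynomial (Fin (n + 1)) k)
    (RingHom.id _) Function.injective_id (fun s => rfl) u rfl (fun x => by
      have h1 : (⊤ : Subalgebra k (MvPolynomial (Fin (n + 1)) k)) ≤ symAlg (W ⊔ k ∙ u) := by
        rw [← adjoin_range_X, hWu]
        refine Algebra.adjoin_mono ?_
        rintro _ ⟨i, rfl⟩
        exact isHomogeneous_X k i
      exact h1 trivial)
  obtain ⟨G, hG⟩ := exists_minimal_freeRes (symConnected hW) PM (hM.symAlg W)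
  exact ⟨G, fun i hi b => FreeRes.shift_lt_of_torVanishes θ (fun j s hs => hs) (symConnected hW)
    (coordConnected k n) (by rw [hθ]; exact hu) PM hM F hF G hG hi b⟩

/-- Restriction of linear syzygies to a coordinate subring of smaller dimension. -/
theorem exists_shift_lt_of_finrank [hfin : Module.Finite (symAlg W) M] {d p s : ℕ}
    (hs : Module.finrank k (coordGrading k n 1) = Module.finrank k W + (s + 1))
    (F : FreeRes (coordGrading k n) ℳ)
    (hF : ∀ i ≤ p + (s + 1), ∀ j, d + i ≤ j → F.TorVanishes i j) :
    ∃ G : FreeRes (symGrading W) ℳ, ∀ i ≤ p, ∀ b, G.shift i b < d + i := by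
  induction s generalizing W p with
  | zero =>
    obtain ⟨u, hu, huW⟩ := SetLike.exists_of_lt (lt_of_le_of_ne hW (by rintro rfl; omega))
    have hW' : W ⊔ k ∙ u ≤ coordGrading k n 1 :=
      sup_le hW ((Submodule.span_singleton_le_iff_mem _ _).2 hu)
    refine exists_torVanishes_of_sup_eq PM hM hW hu huW
      (Submodule.eq_of_le_of_finrank_eq hW' ?_) F hF
    rw [finrank_sup_span hW huW, hs]
  | succ s ih =>
    obtain ⟨u, hu, huW⟩ := SetLike.exists_of_lt (lt_of_le_of_ne hW (by rintro rfl; omega))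
    have hW' : W ⊔ k ∙ u ≤ coordGrading k n 1 :=
      sup_le hW ((Submodule.span_singleton_le_iff_mem _ _).2 hu)
    have := finite_symAlg_of_le (le_sup_left : W ≤ W ⊔ k ∙ u) (M := M)
    obtain ⟨G, hG⟩ := ih (p := p + 1) hW' (by rw [finrank_sup_span hW huW, hs]; ring)
      (fun i hi => hF i (by omega))
    exact exists_torVanishes_of_sup PM hM hW hu huW G fun i hi j hj =>
      GradedComplex.torVanishes_of_shift_lt fun b => (hG i hi b).trans_le hj

/-- Over `k` the module is its own resolution, with generators in degrees `< d`; each variable of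
`W` is then added by a cone, which preserves the bound in every homological degree. -/
theorem exists_freeRes_of_finite [Module.Finite k M] {d : ℕ} (hd : ∀ j, d ≤ j → ℳ j = ⊥) :
    ∃ H : FreeRes (symGrading W) ℳ, ∀ i b, H.shift i b < d + i := by
  obtain ⟨s, hs⟩ : ∃ s, Module.finrank k W = s := ⟨_, rfl⟩
  have hfin := finite_of_le_coordGrading hW
  induction s generalizing W with
  | zero =>
    have hW0 : W = ⊥ := Submodule.finrank_eq_zero.1 hs
    have hirr : irrelevantIdeal (symGrading W) = ⊥ := by
      rw [irrelevantIdeal, Ideal.span_eq_bot]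
      rintro ⟨x, hx⟩ ⟨j, hj, hxj⟩
      change x ∈ coordGrading k n j at hxj
      have hx' := hx
      rw [hW0, symAlg, Submodule.bot_coe, Algebra.adjoin_singleton_zero, Algebra.mem_bot] at hx'
      obtain ⟨c, rfl⟩ := hx'
      have h1 := (coordConnected k n).proj_self ((coordConnected k n).algebraMap_mem c)
      rw [(coordConnected k n).proj_ne (i := j) (j := 0) hxj hj.ne'] at h1
      exact Subtype.ext h1.symm
    have := isNoetherianRing_symAlg hW
    have : Module.Finite (symAlg W) M := Module.Finite.of_restrictScalars_finite k _ M
    obtain ⟨L, hL⟩ := exists_minimal_freeRes (symConnected hW) PM (hM.symAlg W)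
    -- Since `S_+ = 0`, minimality makes all differentials zero. Exactness then forces `ε` to be
    -- injective, so generators of `L_0` lie where `ℳ` is nonzero, and leaves no generators in
    -- positive homological degree.
    have hd0 : ∀ i v, L.d i v = 0 := fun i v => by
      have := mem_basisIrrelevant.1 (hL i v)
      funext b
      simpa [hirr] using this b
    refine ⟨L, fun i b => ?_⟩
    cases i with
    | zero =>
      by_contra! hb
      have h1 := L.ε_mem _ _ ((symConnected hW).single_mem (L.shift 0) b)
      rw [hd _ (by simpa using hb), Submodule.mem_bot] at h1
      obtain ⟨y, hy⟩ := (L.exact_zero _).1 h1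
      rw [hd0] at hy
      simpa using congrFun hy b
    | succ i =>
      exfalso
      obtain ⟨y, hy⟩ := (L.exact i (Pi.single b 1)).1 (hd0 _ _)
      rw [hd0] at hy
      simpa using congrFun hy b
  | succ s ih =>
    obtain ⟨u, hu, hu0⟩ := Submodule.exists_mem_ne_zero_of_ne_bot (p := W) (by
      rintro rfl; simp at hs)
    -- Intersecting a complement of the line `ku` with `W` gives a hyperplane of `W` to induct on.
    obtain ⟨C, hC⟩ := exists_isCompl (k ∙ u)
    have hsup : W ⊓ C ⊔ k ∙ u = W := by
      rw [inf_sup_assoc_of_le _ ((Submodule.span_singleton_le_iff_mem _ _).2 hu), sup_comm,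
        hC.sup_eq_top, inf_top_eq]
    have hnot : u ∉ W ⊓ C := fun h =>
      hu0 (Submodule.disjoint_def.1 hC.disjoint u (Submodule.mem_span_singleton_self u) h.2)
    have hW0 : W ⊓ C ≤ coordGrading k n 1 := inf_le_left.trans hW
    have hfin0 := finite_of_le_coordGrading hW0
    have hrank := finrank_sup_span hW0 hnot
    rw [hsup, hs] at hrank
    obtain ⟨H, hH⟩ := ih hW0 (by omega) hfin0
    let _ := symAlgebra (le_sup_left : W ⊓ C ≤ W ⊓ C ⊔ k ∙ u)
    have := symAlgebra_scalarTower (le_sup_left : W ⊓ C ≤ W ⊓ C ⊔ k ∙ u) (M := M)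
    obtain ⟨θ, hθ⟩ := exists_symAlg_polynomial_equiv hW0 (hW hu) hnot
    have := H.exists_extend_shift_lt θ (fun j s hs => hs) (symConnected hW0)
      (symConnected (hsup.le.trans hW)) hθ PM (hM.symAlg _) hH
    rwa [hsup] at this

end Chain

end GradedSyzygies

/-! ### Geometry: `X ∩ Λ = ∅` makes `R/I` finite over `Sym(W)`. -/

namespace GradedSyzygies

open MvPolynomial

variable {k : Type u} [Field k] {n : ℕ}

section Scheme

variable {X : Scheme.{u}} (ι : X ⟶ Proj (coordGrading k n))
  {I : Ideal (MvPolynomial (Fin (n + 1)) k)}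
  (hIX : DefinesSchemeTheoretically I ι)

include hIX

/-- A subscheme lies in the zero locus of every form of positive degree in a defining ideal. -/
theorem range_subset_zeroLocus {m : ℕ} (hm : 0 < m) {f : MvPolynomial (Fin (n + 1)) k}
    (hf : f ∈ coordGrading k n m) (hfI : f ∈ I) : Set.range ι ⊆ linearZeroLocus {f} := by
  have h1 : awayIdeal I f = ⊤ := by
    rw [awayIdeal, Ideal.comap_eq_top_iff]
    exact Ideal.eq_top_of_isUnit_mem _ (Ideal.mem_map_of_mem _ hfI)
      (IsLocalization.Away.algebraMap_isUnit f)
  have h2 := hIX m hm f hf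
  rw [h1, Ideal.comap_eq_top_iff] at h2
  have h0 : (1 : Γ(X, ι ⁻¹ᵁ Proj.basicOpen (coordGrading k n) f)) = 0 := by
    rw [← map_one (ι.app (Proj.basicOpen (coordGrading k n) f)).hom]
    exact (Ideal.eq_top_iff_one _).1 h2
  have h3 : ι ⁻¹ᵁ Proj.basicOpen (coordGrading k n) f = ⊥ := by
    rw [← X.basicOpen_one (U := ι ⁻¹ᵁ Proj.basicOpen (coordGrading k n) f), ← X.basicOpen_zero (ι ⁻¹ᵁ Proj.basicOpen (coordGrading k n) f)]
    rw [h0]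
  rintro _ ⟨x, rfl⟩
  by_contra hx
  have : x ∈ ι ⁻¹ᵁ Proj.basicOpen (coordGrading k n) f := by
    change f ∉ (ι x).asHomogeneousIdeal
    intro h
    exact hx (Set.singleton_subset_iff.2 h)
  rw [h3] at this
  exact this

/-- When `f` vanishes on `X`, the preimage of `D₊(f)` is empty and its ring of sections is zero.
Hence `(I_f)_0` is the unit ideal, and clearing denominators in `1 ∈ I_f` puts a power of `f` in
`I`. -/
theorem exists_pow_mem_of_disjoint {m : ℕ} (hm : 0 < m) {f : MvPolynomial (Fin (n + 1)) k}
    (hf : f ∈ coordGrading k n m) (hfX : Set.range ι ⊆ linearZeroLocus {f}) :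
    ∃ N, f ^ N ∈ I := by
  have h3 : ι ⁻¹ᵁ Proj.basicOpen (coordGrading k n) f = ⊥ := by
    rw [eq_bot_iff]
    intro x hx
    have h1 : f ∉ (ι x).asHomogeneousIdeal := hx
    exact (h1 (Set.singleton_subset_iff.1 (hfX ⟨x, rfl⟩))).elim
  have h4 : Subsingleton Γ(X, ι ⁻¹ᵁ Proj.basicOpen (coordGrading k n) f) := by
    rw [h3]
    exact CommRingCat.subsingleton_of_isTerminal X.sheaf.isTerminalOfEmpty
  have h2 := hIX m hm f hf
  have h5 : RingHom.ker (ι.app (Proj.basicOpen (coordGrading k n) f)).hom = ⊤ :=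
    (Ideal.eq_top_iff_one _).2 (Subsingleton.elim _ _)
  rw [h5, Ideal.comap_top, awayIdeal, eq_comm,
    Ideal.comap_eq_top_iff, Ideal.eq_top_iff_one, ← map_one (algebraMap (MvPolynomial (Fin (n + 1)) k) (Localization.Away f)),
    IsLocalization.algebraMap_mem_map_algebraMap_iff (Submonoid.powers f)] at h2
  obtain ⟨_, ⟨N, rfl⟩, h⟩ := h2
  exact ⟨N, by simpa using h⟩

theorem eq_zero_of_mem_of_isNondegenerate (hX : IsNondegenerate ι)
    {l : MvPolynomial (Fin (n + 1)) k} (hl : l ∈ coordGrading k n 1) (hlI : l ∈ I) : l = 0 := by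
  by_contra hne
  exact hX l hl hne (range_subset_zeroLocus ι hIX one_pos hl hlI)

/-- A projective Nullstellensatz: a homogeneous prime containing `I + (W)` but not some variable
would be a point of `X ∩ Λ`. So every variable lies in the radical, and a power of the irrelevant
ideal lies in `I + (W)`. -/
theorem coordGrading_le_of_disjoint [IsClosedImmersion ι]
    (hI : I.IsHomogeneous (coordGrading k n))
    {W : Submodule k (MvPolynomial (Fin (n + 1)) k)} (hW : W ≤ coordGrading k n 1)
    (hΛ : Disjoint (Set.range ι)
      (linearZeroLocus (W : Set (MvPolynomial (Fin (n + 1)) k)))) :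
    ∃ N, ∀ j, N ≤ j → ∀ f ∈ coordGrading k n j,
      f ∈ I ⊔ Ideal.span (W : Set (MvPolynomial (Fin (n + 1)) k)) := by
  set K := I ⊔ Ideal.span (W : Set (MvPolynomial (Fin (n + 1)) k)) with hK
  have hKhom : K.IsHomogeneous (coordGrading k n) :=
    hI.sup (Ideal.homogeneous_span _ _ fun w hw => ⟨1, hW hw⟩)
  have hrad : ∀ i : Fin (n + 1), (MvPolynomial.X i : MvPolynomial (Fin (n + 1)) k) ∈ K.radical := by
    intro i
    rw [hKhom.radical_eq, Submodule.mem_sInf]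
    rintro q ⟨hq, hKq, hqp⟩
    by_contra hi
    let x : ProjectiveSpectrum (coordGrading k n) := ⟨⟨q, hq⟩, hqp, fun h => hi (h (by
      exact HomogeneousIdeal.mem_irrelevant_of_mem _ one_pos (isHomogeneous_X k i)))⟩
    have hxW : x ∈ linearZeroLocus (W : Set (MvPolynomial (Fin (n + 1)) k)) := fun w hw =>
      hKq (Ideal.mem_sup_right (Ideal.subset_span hw))
    have hx : x ∉ Set.range ι := fun h => Set.disjoint_left.1 hΛ h hxW
    obtain ⟨s, hs⟩ := (ProjectiveSpectrum.isClosed_iff_zeroLocus (coordGrading k n) _).1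
      ι.isClosedEmbedding.isClosed_range
    rw [hs] at hx
    obtain ⟨g, hgs, hgq⟩ := Set.not_subset.1 hx
    have hgq' : g ∉ q := hgq
    rw [mem_iff_homogeneousComponent_mem hq, not_forall] at hgq'
    obtain ⟨j, hj⟩ := hgq'
    -- The factor `X i` ensures positive degree even when `j = 0`; as `X i ∉ q`, primality still
    -- forces the component of `g` into `q`.
    obtain ⟨N, hN⟩ := exists_pow_mem_of_disjoint ι hIX (Nat.succ_pos j)
      (f := homogeneousComponent j g * MvPolynomial.X i)
      ((coordConnected k n).mul_mem (homogeneousComponent_mem j g) (isHomogeneous_X k i)) (by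
        rw [hs]
        intro y hy
        refine Set.singleton_subset_iff.2 (Ideal.mul_mem_right _ _ ?_)
        exact homogeneousComponent_mem_of_mem y.asHomogeneousIdeal.isHomogeneous (hy hgs) j)
    rcases hqp.mem_or_mem (hqp.mem_of_pow_mem N (hKq (Ideal.mem_sup_left hN))) with h | h
    · exact hj h
    · exact hi h
  have hirr : ∃ N, (Ideal.span (Set.range (MvPolynomial.X : Fin (n + 1) → MvPolynomial (Fin (n + 1)) k))) ^ N
      ≤ K := by
    refine Ideal.exists_pow_le_of_le_radical_of_fg ?_ (Submodule.fg_span (Set.finite_range _))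
    rw [Ideal.span_le]
    rintro _ ⟨i, rfl⟩
    exact hrad i
  obtain ⟨N, hN⟩ := hirr
  refine ⟨N, fun j hj f hf => hN (Ideal.pow_le_pow_right hj ?_)⟩
  rw [coordGrading, ← homogeneousSubmodule_one_pow] at hf
  have h1 : homogeneousSubmodule (Fin (n + 1)) k 1 ≤ (Ideal.span (Set.range
      (MvPolynomial.X : Fin (n + 1) → MvPolynomial (Fin (n + 1)) k))).restrictScalars k := by
    rw [homogeneousSubmodule_one_eq_span_X, Submodule.span_le]
    exact Ideal.subset_span
  clear hj
  induction j generalizing f with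
  | zero => simp
  | succ j ih =>
    rw [pow_succ] at hf ⊢
    induction hf using Submodule.mul_induction_on' with
    | mem_mul_mem a ha b hb => exact Ideal.mul_mem_mul (ih a ha) (h1 hb)
    | add a _ b _ ha hb => exact Ideal.add_mem _ ha hb

end Scheme

section Finiteness

/-- A polynomial times a linear form lies in a given component up to components of one degree
lower. -/
theorem homogeneousComponent_mul_linear {w : MvPolynomial (Fin (n + 1)) k}
    (hw : w ∈ coordGrading k n 1) (r : MvPolynomial (Fin (n + 1)) k) (j : ℕ) :
    homogeneousComponent (j + 1) (r * w) = homogeneousComponent j r * w := by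
  induction r using (coordConnected k n).induction with
  | hz => simp
  | ha x y hx hy => rw [add_mul, map_add, hx, hy, map_add, add_mul]
  | h i x hx =>
    have hxw : x * w ∈ coordGrading k n (i + 1) := IsHomogeneous.mul hx hw
    rw [homogeneousComponent_of_mem hxw, homogeneousComponent_of_mem hx]
    simp only [Nat.add_right_cancel_iff]
    split_ifs <;> simp

/-- Graded Nakayama: above degree `N`, a form is modulo `I` a combination of elements of `W` with
coefficients one degree lower. Forms of degree at most `N` therefore generate. -/
theorem finite_symAlg_quotient {I : Ideal (MvPolynomial (Fin (n + 1)) k)} (hI : IsHomog I)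
    {W : Submodule k (MvPolynomial (Fin (n + 1)) k)} (hW : W ≤ coordGrading k n 1) {N : ℕ}
    (h : ∀ j, N ≤ j → ∀ f ∈ coordGrading k n j,
      f ∈ I ⊔ Ideal.span (W : Set (MvPolynomial (Fin (n + 1)) k))) :
    Module.Finite (symAlg W) (MvPolynomial (Fin (n + 1)) k ⧸ I) := by
  choose B hB using fun j => Module.Finite.iff_fg.1 (finite_coordGrading k n j)
  let t : Set (MvPolynomial (Fin (n + 1)) k) :=
    ⋃ j ∈ Finset.range (N + 1), (B j : Set (MvPolynomial (Fin (n + 1)) k))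
  have ht : t.Finite := Set.Finite.biUnion (Finset.finite_toSet _) fun j _ => Finset.finite_toSet _
  let P : Submodule (symAlg W) (MvPolynomial (Fin (n + 1)) k ⧸ I) :=
    Submodule.span (symAlg W) (Ideal.Quotient.mk I '' t)
  have key : ∀ j, ∀ f ∈ coordGrading k n j, Ideal.Quotient.mk I f ∈ P := by
    intro j
    induction j using Nat.strong_induction_on with
    | _ j ih =>
      intro f hf
      rcases Nat.lt_or_ge j (N + 1) with hj | hj
      · rw [← hB j] at hf
        have h1 : Submodule.span k (B j : Set (MvPolynomial (Fin (n + 1)) k)) ≤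
            (P.restrictScalars k).comap (Ideal.Quotient.mkₐ k I).toLinearMap := by
          refine Submodule.span_le.2 fun b hb => Submodule.subset_span ⟨b, ?_, rfl⟩
          exact Set.mem_biUnion (Finset.mem_coe.2 (Finset.mem_range.2 hj)) hb
        exact h1 hf
      · obtain ⟨j, rfl⟩ : ∃ j', j = j' + 1 := ⟨j - 1, by omega⟩
        have h2 : ∀ b ∈ Ideal.span (W : Set (MvPolynomial (Fin (n + 1)) k)),
            Ideal.Quotient.mk I (homogeneousComponent (j + 1) b) ∈ P := by
          intro b hb
          induction hb using Submodule.closure_induction with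
          | zero => simp
          | add x y _ _ hx hy => rw [map_add, map_add]; exact add_mem hx hy
          | smul_mem r w hw =>
            rw [smul_eq_mul, homogeneousComponent_mul_linear (hW hw), map_mul, mul_comm]
            exact P.smul_mem ⟨w, Algebra.subset_adjoin hw⟩
              (ih j (Nat.lt_succ_self j) _ (homogeneousComponent_mem j r))
        obtain ⟨a, ha, b, hb, rfl⟩ := Submodule.mem_sup.1 (h _ (by omega) f hf)
        have h1 : a + b = homogeneousComponent (j + 1) a + homogeneousComponent (j + 1) b := by
          rw [← map_add, homogeneousComponent_of_mem hf, if_pos rfl]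
        rw [h1, map_add, Ideal.Quotient.eq_zero_iff_mem.2 (hI a ha _), zero_add]
        exact h2 b hb
  refine ⟨⟨(ht.image (Ideal.Quotient.mk I)).toFinset, ?_⟩⟩
  rw [Set.Finite.coe_toFinset, eq_top_iff]
  rintro m -
  obtain ⟨x, rfl⟩ := Ideal.Quotient.mk_surjective m
  obtain ⟨N', hN'⟩ := (coordConnected k n).exists_sum x
  rw [← hN', map_sum]
  exact Submodule.sum_mem _ fun j _ => key j _ ((coordConnected k n).proj_mem j x)

end Finiteness

end GradedSyzygies

/-! ### Freeness of `Sym(U)` over `Sym(W)`, and the identification of the zeroth term. -/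

namespace GradedSyzygies

open MvPolynomial

variable {k : Type u} [Field k] {n : ℕ}

theorem pow_le_toSubmodule {A : Type*} [CommRing A] [Algebra k A] {U : Submodule k A}
    {S : Subalgebra k A} (h : U ≤ Subalgebra.toSubmodule S) (i : ℕ) :
    U ^ i ≤ Subalgebra.toSubmodule S := by
  induction i with
  | zero =>
    rw [pow_zero, Submodule.one_le]
    exact S.one_mem
  | succ i ih =>
    rw [pow_succ, Submodule.mul_le]
    exact fun a ha b hb => S.mul_mem (ih ha) (h hb)

theorem pow_le_coordGrading {U : Submodule k (MvPolynomial (Fin (n + 1)) k)}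
    (hU : U ≤ coordGrading k n 1) (i : ℕ) : U ^ i ≤ coordGrading k n i := by
  rw [coordGrading, ← homogeneousSubmodule_one_pow]
  exact pow_le_pow_left' hU i

section Independence

variable {U W : Submodule k (MvPolynomial (Fin (n + 1)) k)}
  (hUW : Disjoint U W) (hV : U ⊔ W = coordGrading k n 1)

include hUW hV in
/-- The algebra map separating the variables of `U` from those of `W`. -/
theorem exists_separation : ∃ ψ : MvPolynomial (Fin (n + 1)) k →ₐ[k]
    MvPolynomial (Fin (n + 1)) (MvPolynomial (Fin (n + 1)) k),
    (∀ w ∈ W, ψ w = C w) ∧ ∀ x ∈ U, ψ x = map C x := by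
  have hX : ∀ i : Fin (n + 1), ∃ a ∈ U, ∃ c ∈ W, a + c = (X i : MvPolynomial (Fin (n + 1)) k) :=
    fun i => Submodule.mem_sup.1 (hV.ge (isHomogeneous_X k i))
  choose a ha c hc hac using hX
  let ψ : MvPolynomial (Fin (n + 1)) k →ₐ[k]
    MvPolynomial (Fin (n + 1)) (MvPolynomial (Fin (n + 1)) k) :=
    aeval fun i => C (c i) + map C (a i)
  have key : ∀ v ∈ coordGrading k n 1, ∃ x ∈ U, ∃ y ∈ W, x + y = v ∧ ψ v = C y + map C x := by
    intro v hv
    rw [show coordGrading k n 1 = _ from homogeneousSubmodule_one_eq_span_X] at hv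
    induction hv using Submodule.span_induction with
    | mem v hv =>
      obtain ⟨i, rfl⟩ := hv
      exact ⟨a i, ha i, c i, hc i, hac i, by simp [ψ]⟩
    | zero => exact ⟨0, U.zero_mem, 0, W.zero_mem, by simp, by simp⟩
    | add v v' _ _ h h' =>
      obtain ⟨x, hx, y, hy, rfl, h⟩ := h
      obtain ⟨x', hx', y', hy', rfl, h'⟩ := h'
      refine ⟨x + x', U.add_mem hx hx', y + y', W.add_mem hy hy', by ring, ?_⟩
      rw [map_add, h, h', map_add, map_add]
      ring
    | smul r v _ h =>
      obtain ⟨x, hx, y, hy, rfl, h⟩ := h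
      refine ⟨r • x, U.smul_mem _ hx, r • y, W.smul_mem _ hy, by rw [smul_add], ?_⟩
      have hr : algebraMap k (MvPolynomial (Fin (n + 1)) (MvPolynomial (Fin (n + 1)) k)) r =
        C (C r) := rfl
      rw [map_smul, h, smul_eq_C_mul, smul_eq_C_mul, map_mul, map_mul, map_C, Algebra.smul_def, hr]
      ring
  refine ⟨ψ, fun w hw => ?_, fun u hu => ?_⟩
  · obtain ⟨x, hx, y, hy, h, h'⟩ := key w (hV.le (Submodule.mem_sup_right hw))
    have hx0 : x = 0 := Submodule.disjoint_def.1 hUW x hx (by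
      rw [eq_sub_of_add_eq h]; exact W.sub_mem hw hy)
    rw [h', ← h, hx0]
    simp
  · obtain ⟨x, hx, y, hy, h, h'⟩ := key u (hV.le (Submodule.mem_sup_left hu))
    have hy0 : y = 0 := Submodule.disjoint_def.1 hUW y (by
      rw [eq_sub_of_add_eq' h]; exact U.sub_mem hu hx) hy
    rw [h', ← h, hy0]
    simp

include hUW hV in
/-- Forms in `Sym(U)` that are independent over `k` are independent over `Sym(W)`. -/
theorem eq_zero_of_sum_mul_eq_zero {κ : Type*} [Fintype κ] {b : κ → MvPolynomial (Fin (n + 1)) k}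
    (hb : ∀ x, ∃ i, b x ∈ U ^ i) (hind : LinearIndependent k b) (s : κ → symAlg W)
    (h : ∑ x, (s x : MvPolynomial (Fin (n + 1)) k) * b x = 0) (x : κ) : s x = 0 := by
  obtain ⟨ψ, hψW, hψU⟩ := exists_separation hUW hV
  have h1 : ∀ y ∈ symAlg W, ψ y = C y := by
    have : symAlg W ≤ AlgHom.equalizer ψ (IsScalarTower.toAlgHom k (MvPolynomial (Fin (n + 1)) k)
        (MvPolynomial (Fin (n + 1)) (MvPolynomial (Fin (n + 1)) k))) :=
      Algebra.adjoin_le hψW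
    exact this
  have h2 : ∀ i, ∀ y ∈ U ^ i, ψ y = map C y := fun i =>
    pow_le_toSubmodule (S := AlgHom.equalizer ψ
      (mapAlgHom (Algebra.ofId k (MvPolynomial (Fin (n + 1)) k)))) hψU i
  have h3 := congrArg ψ h
  rw [map_sum, map_zero] at h3
  -- After `ψ`, the `s x` are scalars and the `b x` are polynomials in the outer variables.
  -- Comparing outer coefficients here and inner ones in `h5` leaves `k`-linear relations among the
  -- `b x`.
  have h4 : ∀ m, ∑ x, (s x : MvPolynomial (Fin (n + 1)) k) * C (coeff m (b x)) = 0 := by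
    intro m
    have := congrArg (coeff m) h3
    rw [coeff_sum, coeff_zero] at this
    rw [← this]
    refine Finset.sum_congr rfl fun x _ => ?_
    obtain ⟨i, hi⟩ := hb x
    rw [map_mul, h1 _ (s x).2, h2 i _ hi, coeff_C_mul, coeff_map]
  have h5 : ∀ m', ∑ x, coeff m' (s x : MvPolynomial (Fin (n + 1)) k) • b x = 0 := by
    intro m'
    ext m
    have := congrArg (coeff m') (h4 m)
    rw [coeff_sum, coeff_zero] at this ⊢
    rw [← this]
    refine Finset.sum_congr rfl fun x _ => ?_
    rw [coeff_smul, smul_eq_mul, mul_comm _ (C _), coeff_C_mul, mul_comm]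
  apply Subtype.ext
  ext m'
  exact Fintype.linearIndependent_iff.1 hind _ (h5 m') x

end Independence

theorem dfinsuppBasis_repr_lof {S : Type*} [Semiring S] {κ : Type*} [DecidableEq κ] {η : κ → Type*}
    {M : κ → Type*} [∀ i, AddCommMonoid (M i)] [∀ i, Module S (M i)]
    (b : ∀ i, Module.Basis (η i) S (M i)) (i : κ) (c : η i) :
    (DFinsupp.basis b).repr (DirectSum.lof S κ M i (b i c)) = Finsupp.single ⟨i, c⟩ 1 := by
  classical
  ext ⟨j, c'⟩
  have h1 : (DFinsupp.basis b).repr (DirectSum.lof S κ M i (b i c)) ⟨j, c'⟩ =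
    (b j).repr (DFinsupp.single i (b i c) j) c' := rfl
  rw [h1]
  by_cases h : i = j
  · subst h
    rw [DFinsupp.single_eq_same, Module.Basis.repr_self, Finsupp.single_apply,
      Finsupp.single_apply]
    simp
  · rw [DFinsupp.single_eq_of_ne (Ne.symm h), map_zero, Finsupp.single_eq_of_ne]
    · rfl
    · rintro h'; exact h (congrArg Sigma.fst h').symm

section Cover

variable (U : Submodule k (MvPolynomial (Fin (n + 1)) k)) (d : ℕ)

/-- Index set of a basis of the forms of degree `< d` in `Sym(U)`. -/
abbrev SymIndex : Type := Σ i : Fin d, Fin (Module.finrank k ↥(U ^ (i : ℕ)))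

variable {U} (hU : U ≤ coordGrading k n 1)

/-- A basis of the forms of degree `< d` in `Sym(U)`. -/
def symBasis (i : ℕ) : Module.Basis (Fin (Module.finrank k ↥(U ^ i))) k ↥(U ^ i) :=
  haveI := finite_of_le_coordGrading (pow_le_coordGrading hU i)
  Module.finBasis k ↥(U ^ i)

/-- The basis elements as polynomials. -/
def symForm (x : SymIndex U d) : MvPolynomial (Fin (n + 1)) k := symBasis hU x.1 x.2

theorem symForm_mem_pow (x : SymIndex U d) : symForm d hU x ∈ U ^ (x.1 : ℕ) :=
  (symBasis hU x.1 x.2).2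

theorem symForm_mem (x : SymIndex U d) : symForm d hU x ∈ coordGrading k n x.1 :=
  pow_le_coordGrading hU _ (symForm_mem_pow d hU x)

theorem linearIndependent_symForm : LinearIndependent k (symForm d hU) := by
  rw [Fintype.linearIndependent_iff]
  intro g hg
  rw [Fintype.sum_sigma] at hg
  have h1 : ∀ i : Fin d, ∑ c, g ⟨i, c⟩ • symForm d hU ⟨i, c⟩ ∈ coordGrading k n i := fun i =>
    Submodule.sum_mem _ fun c _ => Submodule.smul_mem _ _ (symForm_mem d hU _)
  have h2 : ∀ i : Fin d, ∑ c, g ⟨i, c⟩ • symForm d hU ⟨i, c⟩ = 0 := by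
    intro i
    have := congrArg (homogeneousComponent (i : ℕ)) hg
    rw [map_sum, map_zero, Finset.sum_eq_single i] at this
    · rwa [homogeneousComponent_of_mem (h1 i), if_pos rfl] at this
    · intro j _ hj
      rw [homogeneousComponent_of_mem (h1 j), if_neg (fun h => hj (Fin.ext h.symm))]
    · simp
  rintro ⟨i, c⟩
  have h3 : ∑ c, g ⟨i, c⟩ • symBasis hU i c = 0 := by
    apply Subtype.ext
    rw [AddSubmonoidClass.coe_finsetSum]
    exact h2 i
  exact Fintype.linearIndependent_iff.1 (symBasis hU i).linearIndependent _ h3 c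

/-- An enumeration of the index set. -/
def symEnum : SymIndex U d ≃ Fin (Fintype.card (SymIndex U d)) := Fintype.equivFin _

variable (W : Submodule k (MvPolynomial (Fin (n + 1)) k))

/-- The identification of `⨁_{i<d} Sym(W) ⊗ Symⁱ(U)` with a standard free module. -/
def symEquiv : (DirectSum (Fin d) fun i => symAlg W ⊗[k] ↥(U ^ (i : ℕ))) ≃ₗ[symAlg W]
    (Fin (Fintype.card (SymIndex U d)) → symAlg W) :=
  ((DFinsupp.basis fun i : Fin d =>
    (symBasis hU (i : ℕ)).baseChange (symAlg W)).reindex (symEnum d)).equivFun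

theorem symEquiv_lof_basis (i : Fin d) (c : Fin (Module.finrank k ↥(U ^ (i : ℕ)))) :
    symEquiv d hU W (DirectSum.lof (symAlg W) (Fin d) (fun i => symAlg W ⊗[k] ↥(U ^ (i : ℕ))) i
      (1 ⊗ₜ[k] symBasis hU i c)) = Pi.single (symEnum d ⟨i, c⟩) 1 := by
  rw [← Module.Basis.baseChange_apply]
  funext y
  rw [symEquiv, Module.Basis.equivFun_apply, Module.Basis.repr_reindex_apply,
    dfinsuppBasis_repr_lof (fun i : Fin d => (symBasis hU (i : ℕ)).baseChange (symAlg W)) i c,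
    Finsupp.single_apply, Pi.single_apply]
  by_cases h : y = symEnum d ⟨i, c⟩
  · rw [if_pos h, if_pos (by rw [h, Equiv.symm_apply_apply])]
  · rw [if_neg h, if_neg fun h' => h (by rw [h', Equiv.apply_symm_apply])]

theorem symEquiv_lof (i : Fin d) (x : ↥(U ^ (i : ℕ))) :
    symEquiv d hU W (DirectSum.lof (symAlg W) (Fin d) (fun i => symAlg W ⊗[k] ↥(U ^ (i : ℕ))) i
      (1 ⊗ₜ[k] x)) = ∑ c, (algebraMap k (symAlg W) ((symBasis hU i).repr x c)) •
        (Pi.single (symEnum d ⟨i, c⟩) 1 : Fin (Fintype.card (SymIndex U d)) → symAlg W) := by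
  conv_lhs => rw [← (symBasis hU i).sum_repr x]
  rw [TensorProduct.tmul_sum, map_sum, map_sum]
  refine Finset.sum_congr rfl fun c _ => ?_
  rw [TensorProduct.tmul_smul, ← algebraMap_smul (symAlg W), map_smul, map_smul,
    symEquiv_lof_basis]

end Cover

end GradedSyzygies

/-! ### Betti numbers, truncation, and the explicit cover of `R/J`. -/

namespace GradedSyzygies

open MvPolynomial

section Betti

variable {k : Type*} [Field k] {S : Type*} [CommRing S] [Algebra k S] [Nontrivial S]
  {𝒮 : ℕ → Submodule k S} (hS : ConnectedGrading 𝒮)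

include hS

/-- If a basis vector were a cycle it would be a boundary, hence in `S_+ A`, which is impossible. A
nonzero coordinate of its image lies in `S_+`, so it has positive degree and the target generator
has smaller degree. -/
theorem GradedComplex.exists_shift_lt {A : GradedComplex 𝒮} (hA : A.IsMinimal) (i : ℕ)
    (b : A.ι (i + 1)) : A.d i (Pi.single b 1) ≠ 0 ∧ ∃ c, A.shift i c < A.shift (i + 1) b := by
  have h0 : A.d i (Pi.single b 1) ≠ 0 := fun h => by
    obtain ⟨y, hy⟩ := (A.exact i _).1 h
    exact hS.single_notMem b (hy ▸ hA _ y)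
  refine ⟨h0, ?_⟩
  obtain ⟨c, hc⟩ := Function.ne_iff.1 h0
  refine ⟨c, ?_⟩
  by_contra! hle
  refine hc ?_
  have h1 := mem_basisPart.1 (A.d_mem i _ _ (hS.single_mem _ b)) c
  have h2 := mem_basisIrrelevant.1 (hA i (Pi.single b 1)) c
  rcases eq_or_lt_of_le hle with h | h
  · rw [h, twist_of_le le_rfl, Nat.sub_self] at h1
    exact hS.eq_zero_of_mem_irrelevantIdeal h2 h1
  · rwa [twist_of_lt h, Submodule.mem_bot] at h1

/-- In a minimal resolution the rank of a free module generated in one degree is the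
corresponding graded Betti number. -/
theorem GradedFreeResolution.rank_eq_betti {M : Type*} [AddCommGroup M] [Module k M] [Module S M]
    {ℳ : ℕ → Submodule k M} (L : GradedFreeResolution 𝒮 ℳ) (hL : L.IsMinimal) (i j : ℕ)
    (h : ∀ b, L.shift i b = i + j) : L.rank i = L.betti i j := by
  have hmem : ∀ v : Fin (L.rank i) → S, v ∈ L.part i (i + j) ↔ ∀ b, v b ∈ 𝒮 0 := by
    intro v
    change v ∈ basisPart 𝒮 (L.shift i) (i + j) ↔ _
    rw [mem_basisPart]
    refine forall_congr' fun b => ?_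
    rw [h, twist_of_le le_rfl, Nat.sub_self]
  have hcyc : L.cycles i (i + j) = L.part i (i + j) := by
    cases i with
    | zero => rfl
    | succ i => exact inf_eq_left.2 fun v _ => hL i v
  -- With all generators in degree `i + j`, that degree consists of constant vectors, and these meet
  -- `S_+ F` only in zero.
  have hbd : L.boundaries i (i + j) = ⊥ := by
    have hirr : ∀ v : Fin (L.rank i) → S, v ∈ irrelevantPart 𝒮 (L.rank i) →
        ∀ b, v b ∈ irrelevantIdeal 𝒮 := fun v hv b => hv b trivial
    have h1 : L.part i (i + j) ⊓ irrelevantPart 𝒮 (L.rank i) = ⊥ := by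
      rw [eq_bot_iff]
      rintro v ⟨hv, hv'⟩
      exact funext fun b => hS.eq_zero_of_mem_irrelevantIdeal (hirr v hv' b) ((hmem v).1 hv b)
    rw [GradedFreeResolution.boundaries, h1, bot_sup_eq, eq_bot_iff, ← h1]
    rintro _ ⟨y, hy, rfl⟩
    exact ⟨L.d_homogeneous i _ y hy, hL i y⟩
  have e : (Fin (L.rank i) → k) ≃ₗ[k] L.part i (i + j) := LinearEquiv.ofBijective
    (LinearMap.codRestrict _ ((Algebra.linearMap k S).compLeft (Fin (L.rank i))) fun v =>
      (hmem _).2 fun b => hS.algebraMap_mem (v b)) (by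
    constructor
    · intro v w hvw
      funext b
      exact (algebraMap k S).injective (congrFun (congrArg Subtype.val hvw) b)
    · rintro ⟨v, hv⟩
      choose c hc using fun b => hS.exists_algebraMap ((hmem v).1 hv b)
      exact ⟨c, Subtype.ext (funext hc)⟩)
  have h2 : (L.boundaries i (i + j)).submoduleOf (L.cycles i (i + j)) = ⊥ := by
    rw [hbd]
    exact Submodule.comap_bot _ |>.trans (Submodule.ker_subtype _)
  rw [GradedFreeResolution.betti, (Submodule.quotEquivOfEqBot _ h2).finrank_eq, hcyc,
    ← e.finrank_eq, Module.finrank_fin_fun]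

end Betti

variable {k : Type u} [Field k] {n : ℕ}

section FiniteLength

theorem Projections.finite_of_eq_bot {M : Type*} [AddCommGroup M] [Module k M]
    {ℳ : ℕ → Submodule k M} (P : Projections ℳ) (hfin : ∀ j, Module.Finite k (ℳ j)) {d : ℕ}
    (hd : ∀ j, d ≤ j → ℳ j = ⊥) : Module.Finite k M := by
  have h : (⊤ : Submodule k M) = ⨆ j ∈ Finset.range d, ℳ j := by
    rw [eq_comm, eq_top_iff]
    rintro m -
    rw [← P.sum_of_bound (N := d) (m := m) fun j hj => by
      have := P.proj_mem j m
      rwa [hd j hj, Submodule.mem_bot] at this]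
    exact Submodule.sum_mem _ fun j hj =>
      Submodule.mem_iSup_of_mem j (Submodule.mem_iSup_of_mem hj (P.proj_mem j m))
  rw [Module.finite_def, h]
  exact Submodule.fg_biSup _ _ fun j _ => Module.Finite.iff_fg.1 (hfin j)

end FiniteLength

section Truncation

variable {I J : Ideal (MvPolynomial (Fin (n + 1)) k)}

theorem homogeneousComponent_mul_eq_zero {f : MvPolynomial (Fin (n + 1)) k} {m j : ℕ}
    (hf : f ∈ coordGrading k n m) (hj : j < m) (r : MvPolynomial (Fin (n + 1)) k) :
    homogeneousComponent j (r * f) = 0 := by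
  induction r using (coordConnected k n).induction with
  | hz => simp
  | ha x y hx hy => rw [add_mul, map_add, hx, hy, add_zero]
  | h i x hx =>
    have hxf : x * f ∈ coordGrading k n (i + m) := IsHomogeneous.mul hx hf
    rw [homogeneousComponent_of_mem hxf, if_neg (by omega)]

theorem mem_truncation_iff (hI : IsHomog I) (d : ℕ) {x : MvPolynomial (Fin (n + 1)) k} :
    x ∈ truncation I d ↔ x ∈ I ∧ ∀ j < d, homogeneousComponent j x = 0 := by
  constructor
  · intro hx
    refine ⟨Ideal.span_le.2 (fun f hf => hf.1) hx, fun j hj => ?_⟩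
    induction hx using Submodule.closure_induction with
    | zero => simp
    | add x y _ _ hx hy => rw [map_add, hx, hy, add_zero]
    | smul_mem r f hf =>
      obtain ⟨-, m, hm, hfm⟩ := hf
      exact homogeneousComponent_mul_eq_zero hfm (by omega) r
  · rintro ⟨hx, h⟩
    rw [← sum_homogeneousComponent x]
    refine Ideal.sum_mem _ fun j _ => ?_
    rcases Nat.lt_or_ge j d with hj | hj
    · rw [h j hj]; exact Ideal.zero_mem _
    · exact Ideal.subset_span ⟨hI x hx j, j, hj, homogeneousComponent_mem j x⟩

theorem homogeneousComponent_comp (i j : ℕ) (x : MvPolynomial (Fin (n + 1)) k) :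
    homogeneousComponent i (homogeneousComponent j x) =
      if i = j then homogeneousComponent j x else 0 :=
  homogeneousComponent_of_mem (homogeneousComponent_mem j x)

theorem isHomog_truncation (hI : IsHomog I) (d : ℕ) : IsHomog (truncation I d) := by
  intro x hx j
  rw [mem_truncation_iff hI] at hx ⊢
  refine ⟨hI x hx.1 j, fun i hi => ?_⟩
  rw [homogeneousComponent_comp]
  split_ifs with h
  · rw [← h]; exact hx.2 i hi
  · rfl

end Truncation

section Cover

variable {U W : Submodule k (MvPolynomial (Fin (n + 1)) k)} (d : ℕ)
  (hU : U ≤ coordGrading k n 1) (J : Ideal (MvPolynomial (Fin (n + 1)) k))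

/-- Shifts of the first cover. -/
def coverShift (U : Submodule k (MvPolynomial (Fin (n + 1)) k)) (d : ℕ)
    (x : Fin (Fintype.card (SymIndex U d))) : ℕ := ((symEnum d).symm x).1

/-- The first cover of `R/J` over `Sym(W)`. -/
def coverMap (W : Submodule k (MvPolynomial (Fin (n + 1)) k)) :
    (Fin (Fintype.card (SymIndex U d)) → symAlg W) →ₗ[symAlg W] MvPolynomial (Fin (n + 1)) k ⧸ J :=
  Fintype.linearCombination (symAlg W) fun x =>
    Ideal.Quotient.mk J (symForm d hU ((symEnum d).symm x))

theorem coverMap_mem (j : ℕ) (x : Fin (Fintype.card (SymIndex U d)) → symAlg W)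
    (hx : x ∈ basisPart (symGrading W) (coverShift U d) j) :
    coverMap d hU J W x ∈ quotGrading J j :=
  linearCombination_mem ((gradedSMul_quotGrading J).symAlg W)
    (fun _ => mk_mem_quotGrading (symForm_mem d hU _)) hx

/-- The value of the cover, as a polynomial. -/
def coverPoly (W : Submodule k (MvPolynomial (Fin (n + 1)) k)) :
    (Fin (Fintype.card (SymIndex U d)) → symAlg W) →ₗ[symAlg W] MvPolynomial (Fin (n + 1)) k :=
  Fintype.linearCombination (symAlg W) fun x => symForm d hU ((symEnum d).symm x)

theorem coverMap_eq (x : Fin (Fintype.card (SymIndex U d)) → symAlg W) :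
    coverMap d hU J W x = Ideal.Quotient.mk J (coverPoly d hU W x) := by
  rw [coverMap, coverPoly, Fintype.linearCombination_apply, Fintype.linearCombination_apply,
    map_sum]
  rfl

theorem gradedSMul_coordGrading (W : Submodule k (MvPolynomial (Fin (n + 1)) k)) :
    IsGradedSMul (symGrading W) (coordGrading k n) :=
  fun _ _ _ _ hs hm => IsHomogeneous.mul hs hm

theorem coverPoly_mem {j : ℕ} {x : Fin (Fintype.card (SymIndex U d)) → symAlg W}
    (hx : x ∈ basisPart (symGrading W) (coverShift U d) j) :
    coverPoly d hU W x ∈ coordGrading k n j :=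
  linearCombination_mem (gradedSMul_coordGrading W) (fun _ => symForm_mem d hU _) hx

variable (hUW : Disjoint U W) (hV : U ⊔ W = coordGrading k n 1)

include hUW hV in
theorem coverPoly_injective (x : Fin (Fintype.card (SymIndex U d)) → symAlg W)
    (hx : coverPoly d hU W x = 0) : x = 0 := by
  funext y
  refine eq_zero_of_sum_mul_eq_zero hUW hV (b := fun y => symForm d hU ((symEnum d).symm y))
    (fun y => ⟨_, symForm_mem_pow d hU _⟩)
    ((linearIndependent_symForm d hU).comp _ (symEnum d).symm.injective) x ?_ y
  rw [← hx, coverPoly, Fintype.linearCombination_apply]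
  rfl

variable (hW : W ≤ coordGrading k n 1)

include hUW hV in
-- Below degree `d` nothing is divided out, so the cover inherits injectivity from `Sym(U) ⊗ Sym(W)
-- → R`.
theorem coverMap_eq_zero {J : Ideal (MvPolynomial (Fin (n + 1)) k)}
    (hJd : ∀ j < d, ∀ x ∈ J, x ∈ coordGrading k n j → x = 0)
    {j : ℕ} (hj : j < d) {x : Fin (Fintype.card (SymIndex U d)) → symAlg W}
    (hx : x ∈ basisPart (symGrading W) (coverShift U d) j) (h : coverMap d hU J W x = 0) :
    x = 0 := by
  rw [coverMap_eq, Ideal.Quotient.eq_zero_iff_mem] at h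
  exact coverPoly_injective d hU hUW hV x (hJd j hj _ h (coverPoly_mem d hU hx))

include hUW hV hW in
-- Minimality of the cover: kernel elements have components only in degrees `≥ d`, while all
-- generators have degree `< d`.
theorem mem_basisIrrelevant_of_coverMap {J : Ideal (MvPolynomial (Fin (n + 1)) k)}
    (hJ : IsHomog J) (hJd : ∀ j < d, ∀ x ∈ J, x ∈ coordGrading k n j → x = 0)
    (x : Fin (Fintype.card (SymIndex U d)) → symAlg W) (h : coverMap d hU J W x = 0) :
    x ∈ basisIrrelevant (symGrading W) (Fin (Fintype.card (SymIndex U d))) := by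
  let P := (symConnected hW).freeProj (coverShift U d)
  obtain ⟨N, hN⟩ := P.exists_sum x
  rw [← hN]
  refine Submodule.sum_mem _ fun j _ => ?_
  rcases Nat.lt_or_ge j d with hj | hj
  · rw [coverMap_eq_zero d hU hUW hV hJd hj (P.proj_mem j x)]
    · exact Submodule.zero_mem _
    · have := P.map_proj (quotProj hJ) (coverMap d hU J W).toAddMonoidHom
        (coverMap_mem d hU J) j x
      simp only [LinearMap.toAddMonoidHom_coe] at this
      rw [this, h, map_zero]
  · refine mem_basisIrrelevant_of_lt (fun b => ?_) (P.proj_mem j x)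
    exact (Fin.is_lt ((symEnum d).symm b).1).trans_le hj

include hV in
-- `R` is generated over `Sym(W)` by the powers of `U`, and a form of degree `j` needs only `U ^ l`
-- with `l ≤ j`. Hence all forms of degree `< d` are reached.
theorem exists_coverPoly_of_lt {j : ℕ} (hj : j < d) {x : MvPolynomial (Fin (n + 1)) k}
    (hx : x ∈ coordGrading k n j) : ∃ y, coverPoly d hU W y = x := by
  have hpow : ∀ l < d, ∀ q ∈ U ^ l, ∃ y, coverPoly d hU W y = q := by
    intro l hl q hq
    have h1 := (symBasis hU l).sum_repr ⟨q, hq⟩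
    have h2 := congrArg Subtype.val h1
    rw [AddSubmonoidClass.coe_finsetSum] at h2
    change _ = q at h2
    rw [← h2]
    change _ ∈ LinearMap.range (coverPoly d hU W)
    refine Submodule.sum_mem _ fun c _ => ?_
    refine ⟨Pi.single (symEnum d ⟨⟨l, hl⟩, c⟩)
      (algebraMap k (symAlg W) ((symBasis hU l).repr ⟨q, hq⟩ c)), ?_⟩
    rw [coverPoly, Fintype.linearCombination_apply_single, Equiv.symm_apply_apply,
      algebraMap_smul]
    rfl
  have key : ∀ j, coordGrading k n j ≤ ((Submodule.span (symAlg W)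
      (⋃ l ∈ Set.Iic j, ((U ^ l : Submodule k (MvPolynomial (Fin (n + 1)) k)) :
        Set (MvPolynomial (Fin (n + 1)) k)))).restrictScalars k) := by
    intro j
    induction j with
    | zero =>
      intro x hx
      refine Submodule.subset_span (Set.mem_biUnion (Set.mem_Iic.2 le_rfl) ?_)
      rw [coordGrading, homogeneousSubmodule_zero] at hx
      rwa [pow_zero]
    | succ j ih =>
      rw [coordGrading, ← homogeneousSubmodule_one_pow, pow_succ', homogeneousSubmodule_one_pow,
        Submodule.mul_le]
      intro v hv y hy
      obtain ⟨a, ha, c, hc, rfl⟩ := Submodule.mem_sup.1 (hV.ge hv)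
      have hy' := ih hy
      rw [Submodule.restrictScalars_mem] at hy' ⊢
      clear hy
      induction hy' using Submodule.span_induction with
      | mem y hy =>
        simp only [Set.mem_iUnion] at hy
        obtain ⟨l, hl, hyl⟩ := hy
        rw [add_mul]
        refine Submodule.add_mem _ (Submodule.subset_span (Set.mem_biUnion
          (Set.mem_Iic.2 (Nat.succ_le_succ hl)) ?_)) ?_
        · rw [pow_succ']
          exact Submodule.mul_mem_mul ha hyl
        · exact Submodule.smul_mem _ (⟨c, Algebra.subset_adjoin hc⟩ : symAlg W)
            (Submodule.subset_span (Set.mem_biUnion (Set.mem_Iic.2 (le_trans hl (Nat.le_succ j)))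
              hyl))
      | zero => rw [mul_zero]; exact Submodule.zero_mem _
      | add y z _ _ hy hz => rw [mul_add]; exact Submodule.add_mem _ hy hz
      | smul s y _ hy =>
        rw [mul_smul_comm]
        exact Submodule.smul_mem _ _ hy
  have h1 := key j hx
  rw [Submodule.restrictScalars_mem] at h1
  have h2 : Submodule.span (symAlg W)
      (⋃ l ∈ Set.Iic j, ((U ^ l : Submodule k (MvPolynomial (Fin (n + 1)) k)) :
        Set (MvPolynomial (Fin (n + 1)) k))) ≤ LinearMap.range (coverPoly d hU W) := by
    rw [Submodule.span_le]
    intro q hq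
    simp only [Set.mem_iUnion] at hq
    obtain ⟨l, hl, hql⟩ := hq
    exact hpow l (lt_of_le_of_lt hl hj) q hql
  exact h2 h1

end Cover

end GradedSyzygies

/-! ### The linear resolution of `R/J`. -/

namespace GradedSyzygies

open MvPolynomial

variable {k : Type u} [Field k] {n : ℕ} {U W : Submodule k (MvPolynomial (Fin (n + 1)) k)} (d : ℕ)
  (hU : U ≤ coordGrading k n 1) (hW : W ≤ coordGrading k n 1)
  (hUW : Disjoint U W) (hV : U ⊔ W = coordGrading k n 1)
  {I J : Ideal (MvPolynomial (Fin (n + 1)) k)} (hI : IsHomog I) (hJ : IsHomog J) (hJI : J ≤ I)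
  (hJd : ∀ j < d, ∀ x ∈ J, x ∈ coordGrading k n j → x = 0)
  (hIJ : ∀ j, d ≤ j → ∀ x ∈ I, x ∈ coordGrading k n j → x ∈ J)

section

variable {d}

include hW hV hI hIJ in
-- Forms of degree `< d` are reached already in `R`. In degrees `≥ d` the quotients `R/I` and `R/J`
-- agree, and `R/I` is generated over `Sym(W)` by classes of degree `< d`.
theorem coverMap_surjective (G : FreeRes (symGrading W) (quotGrading I))
    (hG : ∀ b, G.shift 0 b < d) : Function.Surjective (coverMap d hU J W) := by
  have key : ∀ j, ∀ x ∈ coordGrading k n j, Ideal.Quotient.mk J x ∈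
      LinearMap.range (coverMap d hU J W) := by
    intro j x hx
    rcases Nat.lt_or_ge j d with hj | hj
    · obtain ⟨y, rfl⟩ := exists_coverPoly_of_lt d hU hV hj hx
      exact ⟨y, coverMap_eq d hU J y⟩
    · obtain ⟨y, hy, hyx⟩ := ((symConnected hW).freeProj (G.shift 0)).exists_homogeneous_lift
        (quotProj hI) G.ε.toAddMonoidHom G.ε_mem (mk_mem_quotGrading hx) (G.ε_surjective _)
      have hg : ∀ b, ∃ g ∈ coordGrading k n (G.shift 0 b),
          Ideal.Quotient.mk I g = G.ε (Pi.single b 1) := fun b =>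
        G.ε_mem _ _ ((symConnected hW).single_mem _ b)
      choose g hgmem hgε using hg
      have h1 : Ideal.Quotient.mk I (Fintype.linearCombination (symAlg W) g y) = G.ε y := by
        rw [Fintype.linearCombination_apply, map_sum]
        conv_rhs => rw [pi_eq_sum_univ' y, map_sum]
        refine Finset.sum_congr rfl fun b _ => ?_
        rw [LinearMap.map_smul, ← hgε]
        rfl
      have h2 : Fintype.linearCombination (symAlg W) g y ∈ coordGrading k n j :=
        linearCombination_mem (gradedSMul_coordGrading W) hgmem hy
      have h3 : x - Fintype.linearCombination (symAlg W) g y ∈ J := by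
        refine hIJ j hj _ ?_ (Submodule.sub_mem _ hx h2)
        rw [← Ideal.Quotient.eq_zero_iff_mem, map_sub, h1]
        exact sub_eq_zero.2 hyx.symm
      have h4 : Ideal.Quotient.mk J x =
          Ideal.Quotient.mk J (Fintype.linearCombination (symAlg W) g y) :=
        Ideal.Quotient.eq.2 h3
      have h5 : Fintype.linearCombination (symAlg W) g y ∈
          LinearMap.range (coverPoly d hU W) := by
        rw [Fintype.linearCombination_apply]
        exact Submodule.sum_mem _ fun b _ => Submodule.smul_mem _ _
          (exists_coverPoly_of_lt d hU hV (hG b) (hgmem b))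
      obtain ⟨z, hz⟩ := h5
      rw [h4, ← hz]
      exact ⟨z, coverMap_eq d hU J z⟩
  intro m
  obtain ⟨x, rfl⟩ := Ideal.Quotient.mk_surjective m
  obtain ⟨N, hN⟩ := (coordConnected k n).exists_sum x
  rw [← hN, map_sum]
  exact Submodule.sum_mem _ fun j _ => key j _ ((coordConnected k n).proj_mem j x)

include hW hI hJ hIJ in
/-- Upper bounds for the shifts of a minimal resolution of `R/J`, from those for `R/I`. -/
theorem shift_lt_of_le (hJI : J ≤ I) {q : ℕ} (G : FreeRes (symGrading W) (quotGrading I))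
    (hG : ∀ i ≤ q, ∀ b, G.shift i b < d + i) (L : FreeRes (symGrading W) (quotGrading J))
    (hL : L.IsMinimal) {i : ℕ} (hi : i ≤ q) (b : L.ι i) : L.shift i b < d + i := by
  let g : (MvPolynomial (Fin (n + 1)) k ⧸ J) →ₗ[MvPolynomial (Fin (n + 1)) k]
    (MvPolynomial (Fin (n + 1)) k ⧸ I) := Submodule.factor hJI
  have hg : ∀ j, ∀ x ∈ quotGrading J j, g x ∈ quotGrading I j := by
    rintro j _ ⟨x, hx, rfl⟩
    exact ⟨x, hx, rfl⟩
  have hgsurj : Function.Surjective g := Submodule.factor_surjective hJI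
  -- The kernel of `g` is `I/J`, a graded module of finite length concentrated in degrees `< d`.
  have hK : ∀ x ∈ LinearMap.ker g, ∀ j, (quotProj hJ).proj j x ∈ LinearMap.ker g := by
    intro x hx j
    have := (quotProj hJ).map_proj (quotProj hI) g.toAddMonoidHom hg j x
    simp only [LinearMap.toAddMonoidHom_coe] at this
    rw [LinearMap.mem_ker] at hx ⊢
    rw [this, hx, map_zero]
  have hbot : ∀ j, d ≤ j → subGrading (quotGrading J) (LinearMap.ker g) j = ⊥ := by
    intro j hj
    rw [eq_bot_iff]
    rintro ⟨_, hm⟩ ⟨x, hx, rfl⟩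
    have h1 : x ∈ I := Ideal.Quotient.eq_zero_iff_mem.1 hm
    exact Subtype.ext (Ideal.Quotient.eq_zero_iff_mem.2 (hIJ j hj x h1 hx))
  have hfinJ : ∀ j, Module.Finite k (quotGrading J j) := fun j =>
    Module.Finite.iff_fg.2 (Submodule.FG.map _ (Module.Finite.iff_fg.1 (finite_coordGrading k n j)))
  have hfin : Module.Finite k (LinearMap.ker g) :=
    ((quotProj hJ).sub _ hK).finite_of_eq_bot (fun j => by
      have := hfinJ j
      exact Module.Finite.of_injective ((LinearMap.ker g).subtype.restrictScalars k |>.restrict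
        (p := subGrading (quotGrading J) (LinearMap.ker g) j) (q := quotGrading J j)
        fun x hx => hx) (fun x y h => Subtype.ext (Subtype.ext (Subtype.ext_iff.1 h :)))) hbot
  obtain ⟨H, hH⟩ := exists_freeRes_of_finite ((quotProj hJ).sub _ hK)
    ((gradedSMul_quotGrading J).sub _) hW hbot
  exact FreeRes.shift_lt_of_quotient (symConnected hW) (quotProj hJ) (quotProj hI) H L G
    ((LinearMap.ker g).subtype.restrictScalars (symAlg W)) (fun j x hx => hx)
    Subtype.val_injective (g.restrictScalars (symAlg W)) hg hgsurj
    (fun x => ⟨fun hx => ⟨⟨x, hx⟩, rfl⟩, by rintro ⟨y, rfl⟩; exact y.2⟩) hL hH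
    (fun i hi j hj => GradedComplex.torVanishes_of_shift_lt fun b => (hG i hi b).trans_le hj) hi b

include hW in
theorem symEquiv_lof_mem (i : Fin d) (u : ↥(U ^ (i : ℕ))) :
    symEquiv d hU W (DirectSum.lof (symAlg W) (Fin d) (fun i => symAlg W ⊗[k] ↥(U ^ (i : ℕ))) i
      (1 ⊗ₜ[k] u)) ∈ freePart (symGrading W) (coverShift U d) i := by
  rw [symEquiv_lof]
  refine Submodule.sum_mem _ fun c _ => ?_
  rw [algebraMap_smul]
  refine Submodule.smul_mem _ _ ?_
  have := (symConnected hW).single_mem (coverShift U d) (symEnum d ⟨i, c⟩)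
  have h : coverShift U d (symEnum d ⟨i, c⟩) = i := by
    rw [coverShift, Equiv.symm_apply_apply]
  rwa [h] at this

theorem coverMap_symEquiv_lof (i : Fin d) (u : ↥(U ^ (i : ℕ))) :
    coverMap d hU J W (symEquiv d hU W (DirectSum.lof (symAlg W) (Fin d)
      (fun i => symAlg W ⊗[k] ↥(U ^ (i : ℕ))) i (1 ⊗ₜ[k] u))) = Ideal.Quotient.mk J u := by
  rw [symEquiv_lof, coverMap_eq, map_sum]
  congr 1
  have h1 := congrArg Subtype.val ((symBasis hU i).sum_repr u)
  rw [AddSubmonoidClass.coe_finsetSum] at h1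
  rw [← h1]
  refine Finset.sum_congr rfl fun c _ => ?_
  rw [map_smul, coverPoly, Fintype.linearCombination_apply_single, Equiv.symm_apply_apply,
    one_smul, algebraMap_smul]
  rfl

include hU hW hUW hV hI hJ hJI hJd hIJ in
-- Only two properties of `J` matter: it is zero below degree `d` and agrees with `I` from degree
-- `d` on. This serves both `J = I_{≥ d}` and, for `d = 2`, `J = I`.
theorem exists_linear_resolution [Module.Finite (symAlg W) (MvPolynomial (Fin (n + 1)) k ⧸ I)]
    {p t : ℕ} (hd : 1 ≤ d) (ht : 1 ≤ t) (htp : t ≤ p) (hUt : Module.finrank k U = t)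
    (F : FreeRes (coordGrading k n) (quotGrading I))
    (hF : ∀ i ≤ p, ∀ j, d + i ≤ j → F.TorVanishes i j) :
    ∃ L : GradedFreeResolution (symGrading W) (quotGrading J),
      L.IsMinimal ∧
      (∃ e : (DirectSum (Fin d) fun i => symAlg W ⊗[k] ↥(U ^ (i : ℕ))) ≃ₗ[symAlg W]
          (Fin (L.rank 0) → symAlg W),
        ∀ (i : Fin d) (u : ↥(U ^ (i : ℕ))),
          e (DirectSum.lof (symAlg W) (Fin d) (fun i => symAlg W ⊗[k] ↥(U ^ (i : ℕ))) i
            (1 ⊗ₜ[k] u)) ∈ L.part 0 i ∧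
          L.ε (e (DirectSum.lof (symAlg W) (Fin d) (fun i => symAlg W ⊗[k] ↥(U ^ (i : ℕ))) i
            (1 ⊗ₜ[k] u))) = Ideal.Quotient.mk J u) ∧
      (∃ e : SymIndex U d ≃ Fin (L.rank 0), ∀ x, L.shift 0 (e x) = x.1) ∧
      ∀ i, 1 ≤ i → i ≤ p - t →
        L.rank i = L.betti i (d - 1) ∧ ∀ b, L.shift i b = i + d - 1 := by
  have hUfin := finite_of_le_coordGrading hU
  have hWfin := finite_of_le_coordGrading hW
  have hrank : Module.finrank k (coordGrading k n 1) = Module.finrank k W + (t - 1 + 1) := by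
    have := Submodule.finrank_sup_add_finrank_inf_eq U W
    rw [hV, hUW.eq_bot, finrank_bot] at this
    omega
  obtain ⟨G, hG⟩ := exists_shift_lt_of_finrank (quotProj hI) (gradedSMul_quotGrading I) hW
    (p := p - t) hrank F fun i hi => hF i (by omega)
  have hsurj : Function.Surjective (coverMap d hU J W) :=
    coverMap_surjective hU hW hV hI hIJ G (hG 0 (Nat.zero_le _))
  have := isNoetherianRing_symAlg hW
  let L := minimalResolution (symConnected hW) (quotProj hJ) (coverShift U d) (coverMap d hU J W)
    (coverMap_mem d hU J) hsurj
  have hmin : L.toFreeRes.IsMinimal := minimalResolution_isMinimal _ _ _ _ _ _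
    (mem_basisIrrelevant_of_coverMap d hU hUW hV hW hJ hJd)
  have hmin' : L.IsMinimal := fun i v => by
    have := mem_basisIrrelevant.1 (hmin i v)
    intro b _
    exact this b
  -- The kernel of the cover is zero below degree `d`, which bounds `L_1`; each later step of a
  -- minimal resolution raises the least degree by at least one.
  have hlower : ∀ i b, d + i ≤ L.shift (i + 1) b := by
    intro i
    induction i with
    | zero =>
      intro b
      by_contra! hb
      refine (GradedComplex.exists_shift_lt (symConnected hW) hmin 0 b).1 ?_
      exact coverMap_eq_zero d hU hUW hV hJd hb
        (L.d_homogeneous 0 _ _ ((symConnected hW).single_mem (L.shift 1) b))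
        (L.exact_zero.apply_apply_eq_zero _)
    | succ i ih =>
      intro b
      obtain ⟨c, hc⟩ := (GradedComplex.exists_shift_lt (symConnected hW) hmin (i + 1) b).2
      exact Nat.succ_le_of_lt (lt_of_le_of_lt (ih c) hc)
  refine ⟨L, hmin', ⟨symEquiv d hU W, fun i u => ⟨?_, ?_⟩⟩, ⟨symEnum d, fun x => ?_⟩,
    fun i hi hip => ?_⟩
  · exact symEquiv_lof_mem hU hW i u
  · exact coverMap_symEquiv_lof hU i u
  · change coverShift U d (symEnum d x) = _
    rw [coverShift, Equiv.symm_apply_apply]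
  · have hshift : ∀ b, L.shift i b = i + (d - 1) := by
      intro b
      have h1 : L.shift i b < d + i := shift_lt_of_le hW hI hJ hIJ hJI G hG L.toFreeRes hmin hip b
      obtain ⟨i, rfl⟩ : ∃ i', i = i' + 1 := ⟨i - 1, by omega⟩
      have h2 := hlower i b
      omega
    exact ⟨L.rank_eq_betti (symConnected hW) hmin' i (d - 1) hshift, fun b =>
      (hshift b).trans (Nat.add_sub_assoc hd i).symm⟩

end

/-- The degrees of a basis of `k ⊕ U`. -/
theorem exists_equiv_symIndex_two {t : ℕ}
    (hUt : Module.finrank k U = t) : ∃ e : Unit ⊕ Fin t ≃ SymIndex U 2,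
      (∀ a, ((e (Sum.inl a)).1 : ℕ) = 0) ∧ ∀ a, ((e (Sum.inr a)).1 : ℕ) = 1 := by
  have h0 : Module.finrank k ↥(U ^ ((0 : Fin 2) : ℕ)) = 1 := by
    have : U ^ ((0 : Fin 2) : ℕ) = k ∙ (1 : MvPolynomial (Fin (n + 1)) k) := by
      rw [Fin.val_zero, pow_zero, Submodule.one_eq_span]
    rw [this, finrank_span_singleton one_ne_zero]
  have h1 : Module.finrank k ↥(U ^ ((1 : Fin 2) : ℕ)) = t := by
    rw [Fin.val_one, pow_one, hUt]
  refine ⟨⟨Sum.elim (fun _ => ⟨0, Fin.cast h0.symm 0⟩) (fun a => ⟨1, Fin.cast h1.symm a⟩),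
    fun x => if h : x.1 = 0 then Sum.inl () else Sum.inr (Fin.cast (by
      rw [show x.1 = 1 by omega, h1]) x.2), ?_, ?_⟩, fun a => rfl, fun a => rfl⟩
  · rintro (a | a)
    · rfl
    · rfl
  · rintro ⟨i, c⟩
    fin_cases i
    · refine Sigma.ext rfl (heq_of_eq (Fin.ext ?_))
      have h2 : (c : ℕ) < 1 := c.2.trans_eq h0
      exact (Nat.lt_one_iff.1 h2).symm
    · rfl

end GradedSyzygies

/-! ### The theorem. -/

theorem theorem2p7 {k : Type u} [Field k] [IsAlgClosed k] [CharZero k] {n : ℕ}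
    -- a non-degenerate reduced closed subscheme `X` of `ℙⁿ`
    {X : Scheme.{u}} [IsReduced X] (ι : X ⟶ Proj (coordGrading k n)) [IsClosedImmersion ι]
    (hX : IsNondegenerate ι)
    -- `X` satisfies `N_{d,p}` scheme-theoretically with the homogeneous ideal `I`
    (I : Ideal (MvPolynomial (Fin (n + 1)) k)) (hI : I.IsHomogeneous (coordGrading k n))
    (hIX : DefinesSchemeTheoretically I ι)
    (d p t : ℕ) (hd : 2 ≤ d) (hN : SatisfiesN I d p) (ht : 1 ≤ t) (htp : t ≤ p)
    -- `V = U ⊕ W` with `dim U = t`, so that `Λ = Z(W) = ℙ(U)` is a `ℙ^{t-1}`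
    (U W : Submodule k (MvPolynomial (Fin (n + 1)) k))
    (hUW : Disjoint U W) (hV : U ⊔ W = coordGrading k n 1) (hU : Module.finrank k U = t)
    -- `Λ ∩ X = ∅`
    (hΛ : Disjoint (Set.range ι)
      (linearZeroLocus (W : Set (MvPolynomial (Fin (n + 1)) k)))) :
    -- the minimal free resolution of `R / I_{≥ d}` over `S_t = Sym(W)`
    (∃ L : GradedFreeResolution (symGrading W) (quotGrading (truncation I d)),
      L.IsMinimal ∧
      (∃ e : (DirectSum (Fin d) fun i => symAlg W ⊗[k] ↥(U ^ (i : ℕ))) ≃ₗ[symAlg W]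
          (Fin (L.rank 0) → symAlg W),
        ∀ (i : Fin d) (u : ↥(U ^ (i : ℕ))),
          e (DirectSum.lof (symAlg W) (Fin d) (fun i => symAlg W ⊗[k] ↥(U ^ (i : ℕ))) i
            (1 ⊗ₜ[k] u)) ∈ L.part 0 i ∧
          L.ε (e (DirectSum.lof (symAlg W) (Fin d) (fun i => symAlg W ⊗[k] ↥(U ^ (i : ℕ))) i
            (1 ⊗ₜ[k] u))) = Ideal.Quotient.mk (truncation I d) u) ∧
      ∀ i, 1 ≤ i → i ≤ p - t →
        L.rank i = L.betti i (d - 1) ∧ ∀ b, L.shift i b = i + d - 1) ∧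
    -- the case `d = 2`: the minimal free resolution of `R / I` over `S_t`
    (d = 2 →
      ∃ L : GradedFreeResolution (symGrading W) (quotGrading I),
        L.IsMinimal ∧
        (∃ e : Unit ⊕ Fin t ≃ Fin (L.rank 0),
          (∀ a, L.shift 0 (e (Sum.inl a)) = 0) ∧ ∀ a, L.shift 0 (e (Sum.inr a)) = 1) ∧
        ∀ i, 1 ≤ i → i ≤ p - t →
          L.rank i = L.betti i 1 ∧ ∀ b, L.shift i b = i + 1) := by
  have hU1 : U ≤ coordGrading k n 1 := le_sup_left.trans hV.le
  have hW1 : W ≤ coordGrading k n 1 := le_sup_right.trans hV.le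
  have hI' : IsHomog I := fun x hx j => MvPolynomial.homogeneousComponent_mem_of_mem hI hx j
  obtain ⟨N, hK⟩ := coordGrading_le_of_disjoint ι hIX hI hW1 hΛ
  have hfin := finite_symAlg_quotient hI' hW1 hK
  obtain ⟨F, hF⟩ := hN
  have hF' : ∀ i ≤ p, ∀ j, d + i ≤ j → F.toFreeRes.TorVanishes i j :=
    fun i hi j hj => F.torVanishes (hF i hi j hj)
  constructor
  · obtain ⟨L, h1, h2, -, h3⟩ := exists_linear_resolution hU1 hW1 hUW hV hI'
      (isHomog_truncation hI' d) (fun x hx => ((mem_truncation_iff hI' d).1 hx).1)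
      (fun j hj x hx hxj => by
        have := ((mem_truncation_iff hI' d).1 hx).2 j hj
        rwa [MvPolynomial.homogeneousComponent_of_mem hxj, if_pos rfl] at this)
      (fun j hj x hx hxj => Ideal.subset_span ⟨hx, j, hj, hxj⟩)
      (by omega) ht htp hU F.toFreeRes hF'
    exact ⟨L, h1, h2, h3⟩
  · rintro rfl
    have hI1 : ∀ x ∈ I, x ∈ coordGrading k n 1 → x = 0 := fun x hx hx1 =>
      eq_zero_of_mem_of_isNondegenerate ι hIX hX hx1 hx
    obtain ⟨L, h1, -, ⟨e, he⟩, h3⟩ := exists_linear_resolution hU1 hW1 hUW hV hI' hI' le_rfl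
      (fun j hj x hx hxj => by
        obtain rfl | rfl : j = 0 ∨ j = 1 := by omega
        -- Non-degeneracy speaks of linear forms only, so a constant in `I` is first multiplied by a
        -- variable.
        · have hx1 : x * MvPolynomial.X 0 ∈ coordGrading k n 1 := by
            have := MvPolynomial.IsHomogeneous.mul hxj (MvPolynomial.isHomogeneous_X k (0 : Fin (n + 1)))
            rwa [zero_add] at this
          have := hI1 _ (I.mul_mem_right _ hx) hx1
          exact (mul_eq_zero.1 this).resolve_right (MvPolynomial.X_ne_zero 0)
        · exact hI1 x hx hxj)
      (fun j hj x hx _ => hx) (by omega) ht htp hU F.toFreeRes hF'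
    obtain ⟨e', h0, h1'⟩ := exists_equiv_symIndex_two hU
    refine ⟨L, h1, ⟨e'.trans e, fun a => ?_, fun a => ?_⟩, h3⟩
    · rw [Equiv.trans_apply, he, h0]
    · rw [Equiv.trans_apply, he, h1']

end
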